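/- For $x\in\mathbb{Z}^n$ let $a_1,\dots,a_n$ be the coordinates of $x$ rearranged so that $|a_1|\ge\dots\ge|a_n|$, and let $\|x_{-j}\|_2^2=\sum_{i=j+1}^n a_i^2$. For every real constant $c$, every integer constant $d\ge 0$ and every constant $\delta>0$ there is a constant $C$ such that the following holds for all $n\ge 2$, all $p\in[1,2]$ and all $\varepsilon\in(0,1)$. There is a randomized linear sketch (an integer matrix $S$ with $n$ columns that is drawn, by means of uniformly random bits, independently of the input, together with a rule that computes a nonnegative integer $\tilde k$ from the random bits and $Sx$) that uses at most $C(\log_2 n/\varepsilon)^C$ bits of space, counting the random bits and the bits needed to store $Sx$ for every $x$ with $\|x\|_\infty\le n^d$, and has this property: whenever $x\in\mathbb{Z}^n$ with $\|x\|_\infty\le n^d$, $k$ is the largest integer with $0\le k\le n$ and $$\sum_{i=1}^k|a_i|^p\ \ge\ k^{p+1},$$ and $$a_{j}^2\ \ge\ \Big(\frac{\varepsilon}{\log_2 n}\Big)^{c}\cdot\frac{\|x_{-j}\|_2^2}{j}\qquad\text{for } j=(1-\varepsilon)k,$$ then $$(1-\varepsilon)k\ \le\ \tilde k\ \le\ (1+\varepsilon)(k+1)$$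 with probability at least $1-\delta$. Here, if $(1-\varepsilon)k$ is not an integer, $j$ may be either of the two neighbouring integers, and for $j=0$ the condition is read as $x=0$. -/

import Mathlib

/-- `rearr x i` is the `i`-th coordinate `a_i` (`1 ≤ i ≤ n`) of the vector obtained from `x` by
rearranging its coordinates in non-increasing order of absolute value (ties broken by position).
Outside `1 ≤ i ≤ n` the value is `0`. -/
def rearr {n : ℕ} (x : Fin n → ℤ) (i : ℕ) : ℤ :=
  if h : 1 ≤ i ∧ i ≤ n then
    x (Tuple.sort (fun l => -|x l|) ⟨i - 1, by omega⟩)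
  else 0

/-- The `F_p` moment of the top `k` frequencies, `∑_{i=1}^k |a_i|^p`. -/
noncomputable def topMoment {n : ℕ} (p : ℝ) (x : Fin n → ℤ) (k : ℕ) : ℝ :=
  ∑ i ∈ Finset.Icc 1 k, ((|rearr x i| : ℤ) : ℝ) ^ p

/-- `‖x_{-k}‖_2^2`, where `x_{-k}` is `x` without its top `k` frequencies. -/
def tailSq {n : ℕ} (x : Fin n → ℤ) (k : ℕ) : ℤ :=
  ∑ i ∈ Finset.Icc (k + 1) n, rearr x i ^ 2

/-- `k` is the largest integer `0 ≤ k ≤ n` with `∑_{i=1}^k |a_i|^p ≥ k^{p+1}`. -/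
def IsGIndex {n : ℕ} (p : ℝ) (x : Fin n → ℤ) (k : ℕ) : Prop :=
  IsGreatest {j : ℕ | j ≤ n ∧ (j : ℝ) ^ (p + 1) ≤ topMoment p x j} k

/-- A (randomized) linear sketch on `ℤ^n` with answers in `ℕ`. Uniformly random bits, drawn
independently of the input, determine an integer sketching matrix `S`; the answer is computed from
the random bits and from `S x`. -/
structure LinearSketch (n : ℕ) where
  /-- the number of random bits -/
  seedBits : ℕ
  /-- the number of rows of the sketching matrix -/
  rows : ℕ
  /-- the sketching matrix determined by the random bits -/
  mat : (Fin seedBits → Bool) → Matrix (Fin rows) (Fin n) ℤ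
  /-- the post-processing -/
  decode : (Fin seedBits → Bool) → (Fin rows → ℤ) → ℕ

namespace LinearSketch

variable {n : ℕ}

/-- The answer on input `x` when the random bits are `s`. -/
def output (A : LinearSketch n) (s : Fin A.seedBits → Bool) (x : Fin n → ℤ) : ℕ :=
  A.decode s ((A.mat s).mulVec x)

/-- On vectors whose coordinates are at most `m` in absolute value, the sketch can be maintained in
at most `B` bits: for some `w`, every coordinate of `S x` is always less than `2 ^ w` in absolute
value, so that it is stored with `w` bits and a sign bit; the random bits are stored as well. -/
def UsesBits (A : LinearSketch n) (m : ℤ) (B : ℝ) : Prop :=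
  ∃ w : ℕ,
    (∀ (s : Fin A.seedBits → Bool) (x : Fin n → ℤ), (∀ i, |x i| ≤ m) →
      ∀ j, |(A.mat s).mulVec x j| < 2 ^ w) ∧
    ((A.seedBits + A.rows * (w + 1) : ℕ) : ℝ) ≤ B

open Classical in
/-- The probability, over uniform random bits, that the answer on input `x` satisfies `P`. -/
noncomputable def prob (A : LinearSketch n) (x : Fin n → ℤ) (P : ℕ → Prop) : ℝ :=
  ((Finset.univ.filter fun s : Fin A.seedBits → Bool => P (A.output s x)).card : ℝ) /
    2 ^ A.seedBits

end LinearSketch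

/-! Put `Q = ⌈log₂ n / ε⌉`. The sketch samples the coordinates at the rates `2 ^ (-l)`, `l ≤ Q`, and
at each rate hashes the survivors with random signs into polynomially many (in `Q`) buckets.
Decoding is by exhaustive search: among all inputs `y` that satisfy the promise, have the observed
sketch and are represented well by the seed (`Good`), it returns the largest `⌈(1 - ε) k(y)⌉`. The
true input `x` is a candidate, which gives the lower bound. The upper bound says that two well
represented promise inputs with equal sketches satisfy `⌈(1 - ε) k(y)⌉ ≤ (1 + ε) (k(x) + 1)`
(`ceil_index_le`).

Suppose this fails and put `m = ⌈(1 - ε) k(y)⌉`. Averages of top moments are non-increasing, so the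
top-`m` moment `M` of `y` is at least `1 + ε` times that of `x`. The top-`m` moment is the minimum
over `t` of `m t + ∑ (|x_i|^p - t)₊`; hence at some threshold `t` of a small grid the excess sums of
`y` and `x` differ by at least `M / (4 Q)` (`exists_threshold`). The excess telescopes into pieces
at `S` dyadic scales `v`, with `S` linear in `Q`, and the pieces at each scale differ by at most `M
/ (8 Q S)` (`piece_gap_le`): a contradiction.

A piece at scale `v` vanishes on `[-v, v]` and is bounded and Lipschitz. Summed over the buckets at
rate `2 ^ (-l)` it is therefore close to `2 ^ (-l)` times its sum over the coordinates, provided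
that at this rate few entries exceed `v` and little square mass lies below: large entries rarely
collide and small ones only add weak noise (`expect_bucket_le`, `card_bad_buckets_le`). The tail
condition in the promise provides this lightness (`isLight_of_tail`) at the rate where `2 ^ l * v ^
p` is a suitable small fraction of `M`, and there the error is small compared with `M`.

Independent randomness for every coordinate would be too long to store. Since there are few integer
inputs in the box, a fixed family of `2 ^ r` choices, with `r = O(Q)`, serves all inputs
(`exists_common_seeds`). -/

open scoped BigOperators

/-! ### Moments of sums of independent coordinates -/

section Resampling

variable {ι Ξ : Type*} [DecidableEq ι]

lemma sum_update_eq {A : Finset ι} {i : ι} (hi : i ∉ A) (φ : ι → Ξ → ℝ) (ω : ι → Ξ) (c : Ξ) :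
    ∑ j ∈ A, φ j (Function.update ω i c j) = ∑ j ∈ A, φ j (ω j) := by
  refine Finset.sum_congr rfl fun j hj => ?_
  rw [Function.update_of_ne (by rintro rfl; exact hi hj)]

variable [Fintype ι] [Fintype Ξ] [Nonempty Ξ]

/-- Resampling one coordinate of a uniformly random tuple does not change expectations. -/
lemma expect_resample (i : ι) (G : (ι → Ξ) → ℝ) :
    𝔼 ω, 𝔼 c, G (Function.update ω i c) = 𝔼 ω, G ω := by
  classical
  have h : 𝔼 q : (ι → Ξ) × Ξ, G (Function.update q.1 i q.2) = 𝔼 q : (ι → Ξ) × Ξ, G q.1 := by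
    -- Exchanging coordinate `i` with the fresh sample is an involution.
    refine Finset.expect_nbij' (fun q => (Function.update q.1 i q.2, q.1 i))
      (fun q => (Function.update q.1 i q.2, q.1 i)) ?_ ?_ ?_ ?_ ?_ <;> simp
  rw [← Finset.univ_product_univ, Finset.expect_product, Finset.expect_product] at h
  simpa using h

lemma expect_mul_coord (i : ι) (A : (ι → Ξ) → ℝ) (hA : ∀ ω c, A (Function.update ω i c) = A ω)
    (φ : Ξ → ℝ) : 𝔼 ω, A ω * φ (ω i) = (𝔼 ω, A ω) * 𝔼 c, φ c := by
  rw [← expect_resample i, Finset.expect_mul]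
  refine Finset.expect_congr rfl fun ω _ => ?_
  simp only [hA, Function.update_self, ← Finset.mul_expect]

lemma expect_coord (i : ι) (φ : Ξ → ℝ) : 𝔼 ω : ι → Ξ, φ (ω i) = 𝔼 c, φ c := by
  have h := expect_mul_coord (Ξ := Ξ) i (fun _ => 1) (fun _ _ => rfl) φ
  simpa using h

/-- The cross terms vanish because the summands are independent and centred. -/
lemma expect_sq_sum (φ : Ξ → ℝ) (h1 : 𝔼 c, φ c = 0) (a : ι → ℝ) (A : Finset ι) :
    𝔼 ω : ι → Ξ, (∑ i ∈ A, φ (ω i) * a i) ^ 2 = (𝔼 c, φ c ^ 2) * ∑ i ∈ A, a i ^ 2 := by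
  induction A using Finset.induction_on with
  | empty => simp
  | insert i A hi ih =>
    have hS (ω : ι → Ξ) (c : Ξ) := sum_update_eq hi (fun j x => φ x * a j) ω c
    have e1 := expect_mul_coord i (fun ω : ι → Ξ => ∑ j ∈ A, φ (ω j) * a j) hS φ
    have e2 := expect_coord (ι := ι) i (fun c => φ c ^ 2)
    have key : ∀ ω : ι → Ξ, (∑ j ∈ insert i A, φ (ω j) * a j) ^ 2 =
        (∑ j ∈ A, φ (ω j) * a j) ^ 2 + (2 * a i) * ((∑ j ∈ A, φ (ω j) * a j) * φ (ω i))
          + a i ^ 2 * φ (ω i) ^ 2 := by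
      intro ω
      rw [Finset.sum_insert hi]; ring
    simp_rw [key, Finset.expect_add_distrib, ← Finset.mul_expect, e1, e2, ih, h1]
    rw [Finset.sum_insert hi]
    ring

/-- When a coordinate is added, the terms in which it has exponent 1 or 3 vanish. The condition `h4`
is met by variables with values in `{0, 1, -1}`. -/
lemma expect_pow_four_sum_le (φ : Ξ → ℝ) (h1 : 𝔼 c, φ c = 0) (h3 : 𝔼 c, φ c ^ 3 = 0)
    (h4 : 𝔼 c, φ c ^ 4 = 𝔼 c, φ c ^ 2) (a : ι → ℝ) (A : Finset ι) :
    𝔼 ω : ι → Ξ, (∑ i ∈ A, φ (ω i) * a i) ^ 4 ≤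
      3 * ((𝔼 c, φ c ^ 2) * ∑ i ∈ A, a i ^ 2) ^ 2 + (𝔼 c, φ c ^ 2) * ∑ i ∈ A, a i ^ 4 := by
  induction A using Finset.induction_on with
  | empty => simp
  | insert i A hi ih =>
    have hS (ω : ι → Ξ) (c : Ξ) := sum_update_eq hi (fun j x => φ x * a j) ω c
    have e1 := expect_mul_coord i (fun ω : ι → Ξ => (∑ j ∈ A, φ (ω j) * a j) ^ 3)
      (fun ω c => by simp only [hS]) φ
    have e2 := expect_mul_coord i (fun ω : ι → Ξ => (∑ j ∈ A, φ (ω j) * a j) ^ 2)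
      (fun ω c => by simp only [hS]) (fun c => φ c ^ 2)
    have e3 := expect_mul_coord i (fun ω : ι → Ξ => ∑ j ∈ A, φ (ω j) * a j) hS (fun c => φ c ^ 3)
    have e4 := expect_coord (ι := ι) i (fun c => φ c ^ 4)
    have e5 := expect_sq_sum φ h1 a A
    have key : ∀ ω : ι → Ξ, (∑ j ∈ insert i A, φ (ω j) * a j) ^ 4 =
        (∑ j ∈ A, φ (ω j) * a j) ^ 4 + (4 * a i) * ((∑ j ∈ A, φ (ω j) * a j) ^ 3 * φ (ω i))
          + (6 * a i ^ 2) * ((∑ j ∈ A, φ (ω j) * a j) ^ 2 * φ (ω i) ^ 2)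
          + (4 * a i ^ 3) * ((∑ j ∈ A, φ (ω j) * a j) * φ (ω i) ^ 3)
          + a i ^ 4 * φ (ω i) ^ 4 := by
      intro ω
      rw [Finset.sum_insert hi]; ring
    simp_rw [key, Finset.expect_add_distrib, ← Finset.mul_expect, e1, e2, e3, e4, e5, h1, h3, h4]
    rw [Finset.sum_insert hi, Finset.sum_insert hi]
    nlinarith [sq_nonneg ((𝔼 c, φ c ^ 2) * a i ^ 2)]

lemma expect_mul_two_coords {i j : ι} (hij : i ≠ j) (φ ψ : Ξ → ℝ) :
    𝔼 ω : ι → Ξ, φ (ω i) * ψ (ω j) = (𝔼 c, φ c) * 𝔼 c, ψ c := by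
  rw [expect_mul_coord j (fun ω => φ (ω i)) (fun ω c => by rw [Function.update_of_ne hij]) ψ,
    expect_coord]

/-- Markov's inequality for the uniform distribution. -/
lemma card_filter_le_of_expect {Ω : Type*} [Fintype Ω] (f : Ω → ℝ) (hf : ∀ ω, 0 ≤ f ω)
    (P : Ω → Prop) [DecidablePred P] {a : ℝ} (hP : ∀ ω, P ω → a ≤ f ω) :
    a * (Finset.univ.filter P).card ≤ (𝔼 ω, f ω) * Fintype.card Ω := by
  have h1 : a * (Finset.univ.filter P).card ≤ ∑ ω ∈ Finset.univ.filter P, f ω := by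
    rw [mul_comm, ← nsmul_eq_mul]
    exact Finset.card_nsmul_le_sum _ _ _ fun ω hω => hP ω (Finset.mem_filter.1 hω).2
  have h2 : ∑ ω ∈ Finset.univ.filter P, f ω ≤ ∑ ω, f ω :=
    Finset.sum_le_sum_of_subset_of_nonneg (Finset.filter_subset _ _) fun ω _ _ => hf ω
  have h3 := Fintype.card_mul_expect f
  linarith [mul_comm (𝔼 ω, f ω) (Fintype.card Ω : ℝ)]

end Resampling

/-! ### Reducing the number of random bits -/

/-- A family of `2 ^ r` seeds that works for all inputs at once, obtained by sampling from a finite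
probability space that works for each input separately. -/
theorem exists_common_seeds {Ω X : Type*} [Fintype Ω] [Nonempty Ω] (𝒳 : Finset X)
    (bad : X → Ω → Prop) {δ lam : ℝ} (hlam : 4 ≤ lam ^ δ) (hl : 1 ≤ lam) (r : ℕ)
    (hbad : ∀ x ∈ 𝒳, ∀ [DecidablePred (bad x)],
      lam * (Finset.univ.filter (bad x)).card ≤ Fintype.card Ω)
    (hcard : 𝒳.card < 2 ^ 2 ^ r) :
    ∃ g : (Fin r → Bool) → Ω, ∀ x ∈ 𝒳, ∀ [DecidablePred fun s => bad x (g s)],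
      ((Finset.univ.filter fun s => bad x (g s)).card : ℝ) ≤ δ * 2 ^ r := by
  classical
  set I := Fin r → Bool
  have hI : Fintype.card I = 2 ^ r := by simp [I]
  -- Exponential Markov bound for a random family. One draw has mean weight at most 2, so the
  -- product of the weights has mean at most `2 ^ 2 ^ r`; on an input where the family fails the
  -- product exceeds `lam ^ (δ * 2 ^ r) ≥ 4 ^ 2 ^ r`. Fewer than `2 ^ 2 ^ r` inputs cannot make
  -- every family fail.
  by_contra hcon
  push Not at hcon
  -- the weight of a family of seeds on an input
  let w : X → Ω → ℝ := fun x ω => if bad x ω then lam else 1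
  have hw1 : ∀ x ω, 1 ≤ w x ω := by intro x ω; simp only [w]; split_ifs <;> linarith
  have hsum : ∀ x ∈ 𝒳, ∑ ω, w x ω ≤ 2 * Fintype.card Ω := by
    intro x hx
    have h1 : ∑ ω, w x ω ≤ ∑ ω : Ω, ((if bad x ω then lam else 0) + 1) := by
      refine Finset.sum_le_sum fun ω _ => ?_
      simp only [w]; split_ifs <;> linarith
    rw [Finset.sum_add_distrib, ← Finset.sum_filter] at h1
    have := hbad x hx
    simp only [Finset.sum_const, nsmul_eq_mul, Finset.card_univ, mul_one] at h1
    linarith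
  have hprod : ∀ x ∈ 𝒳, ∑ g : I → Ω, ∏ s, w x (g s) ≤ (2 * Fintype.card Ω : ℝ) ^ 2 ^ r := by
    intro x hx
    have : ∑ g : I → Ω, ∏ s, w x (g s) = (∑ ω, w x ω) ^ 2 ^ r := by
      rw [← hI, ← Finset.card_univ, ← Finset.prod_const, Finset.prod_univ_sum]
      simp
    rw [this]
    exact pow_le_pow_left₀ (Finset.sum_nonneg fun ω _ => by linarith [hw1 x ω]) (hsum x hx) _
  have hbig : ∀ g : I → Ω, (4 : ℝ) ^ 2 ^ r ≤ ∑ x ∈ 𝒳, ∏ s, w x (g s) := by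
    intro g
    obtain ⟨x, hx, hd, hxg⟩ := hcon g
    have h1 : (4 : ℝ) ^ 2 ^ r ≤ ∏ s, w x (g s) := by
      have e : ∏ s, w x (g s) = lam ^ (Finset.univ.filter fun s => bad x (g s)).card := by
        simp only [w]
        rw [← Finset.prod_const, Finset.prod_filter]
        refine Finset.prod_congr rfl fun s _ => ?_
        split_ifs <;> rfl
      rw [e]
      calc (4 : ℝ) ^ 2 ^ r ≤ (lam ^ δ) ^ 2 ^ r := pow_le_pow_left₀ (by norm_num) hlam _
        _ = lam ^ (δ * 2 ^ r) := by
          rw [← Real.rpow_natCast, ← Real.rpow_mul (by linarith)]; push_cast; rfl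
        _ ≤ lam ^ ((Finset.univ.filter fun s => bad x (g s)).card : ℝ) := by
          refine Real.rpow_le_rpow_of_exponent_le hl ?_
          convert hxg.le
        _ = _ := Real.rpow_natCast _ _
    exact h1.trans (Finset.single_le_sum
      (f := fun x => ∏ s, w x (g s))
      (fun x _ => Finset.prod_nonneg fun s _ => by linarith [hw1 x (g s)]) hx)
  have htot : (Fintype.card (I → Ω) : ℝ) * 4 ^ 2 ^ r ≤ 𝒳.card * (2 * Fintype.card Ω : ℝ) ^ 2 ^ r := by
    calc (Fintype.card (I → Ω) : ℝ) * 4 ^ 2 ^ r = ∑ _g : I → Ω, (4 : ℝ) ^ 2 ^ r := by simp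
      _ ≤ ∑ g : I → Ω, ∑ x ∈ 𝒳, ∏ s, w x (g s) := Finset.sum_le_sum fun g _ => hbig g
      _ = ∑ x ∈ 𝒳, ∑ g : I → Ω, ∏ s, w x (g s) := Finset.sum_comm
      _ ≤ ∑ _x ∈ 𝒳, (2 * Fintype.card Ω : ℝ) ^ 2 ^ r := Finset.sum_le_sum hprod
      _ = _ := by simp
  have hΩ : (0 : ℝ) < (Fintype.card Ω : ℝ) ^ 2 ^ r := by
    have : 0 < Fintype.card Ω := Fintype.card_pos
    positivity
  rw [Fintype.card_fun, hI, mul_pow, show (4 : ℝ) = 2 * 2 by norm_num, mul_pow] at htot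
  push_cast at htot
  have hc : (𝒳.card : ℝ) < 2 ^ 2 ^ r := by exact_mod_cast hcard
  have h2 : (0 : ℝ) < 2 ^ 2 ^ r := by positivity
  nlinarith [mul_lt_mul_of_pos_right hc (mul_pos h2 hΩ)]

/-! ### Test functions and their near-additivity -/

/-- A test function: even, `1`-Lipschitz, with values in `[0, 1]`, vanishing on `[-1, 1]`. -/
structure IsTestFun (F : ℝ → ℝ) : Prop where
  nonneg : ∀ u, 0 ≤ F u
  le_one : ∀ u, F u ≤ 1
  eq_zero : ∀ u, |u| ≤ 1 → F u = 0
  even : ∀ u, F (-u) = F u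
  lipschitz : ∀ u v, |F u - F v| ≤ |u - v|

namespace IsTestFun

variable {F : ℝ → ℝ}

/-- The power 4 is what makes noise harmless: summed over `B` buckets, the squares of the noise keep
a total independent of `B`, whereas the main part of the fourth moments decays like `1 / B`. -/
lemma le_pow_four (hF : IsTestFun F) (u : ℝ) : F u ≤ u ^ 4 := by
  by_cases h : |u| ≤ 1
  · rw [hF.eq_zero u h]; positivity
  · have h1 : 1 ≤ u ^ 2 := by
      rw [← sq_abs]; nlinarith [not_le.1 h]
    have := hF.le_one u
    nlinarith

lemma sq_le_min (hF : IsTestFun F) (u : ℝ) : F u ^ 2 ≤ min (u ^ 2) 1 := by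
  have h0 := hF.nonneg u
  have h1 := hF.le_one u
  by_cases h : |u| ≤ 1
  · rw [hF.eq_zero u h]; simp [sq_nonneg]
  · have h2 : 1 ≤ u ^ 2 := by
      rw [← sq_abs]; nlinarith [not_le.1 h]
    rw [min_eq_right h2]; nlinarith

/-- The deviation of `F` at a signed sum from additivity over the heavy entries `H`, the light
entries contributing the noise `s`. -/
lemma abs_sub_le (hF : IsTestFun F) {ι : Type*} [DecidableEq ι] (X : ι → ℝ)
    (hX : ∀ i, X i = 0 ∨ X i = 1 ∨ X i = -1) (x : ι → ℝ) (H : Finset ι) (s : ℝ) {β : ℝ}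
    (hβ : 0 < β) :
    |F (s + ∑ i ∈ H, X i * x i) - ∑ i ∈ H, X i ^ 2 * F (x i)| ≤
      (∑ i ∈ H, ∑ j ∈ H.erase i, X i ^ 2 * X j ^ 2) + (∑ i ∈ H, X i ^ 2 * (β + s ^ 2 / β)) +
        s ^ 4 := by
  set A := H.filter fun i => X i ≠ 0
  have hAH : A ⊆ H := Finset.filter_subset _ _
  have hA : ∀ i ∈ A, X i ^ 2 = 1 := by
    intro i hi
    rcases hX i with h | h | h
    · exact absurd h (Finset.mem_filter.1 hi).2
    · simp [h]
    · simp [h]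
  have hX0 : ∀ i ∈ H, i ∉ A → X i = 0 := by
    intro i hi h
    by_contra h'
    exact h (Finset.mem_filter.2 ⟨hi, h'⟩)
  have e1 : ∑ i ∈ H, X i * x i = ∑ i ∈ A, X i * x i :=
    (Finset.sum_subset hAH fun i hi h => by rw [hX0 i hi h, zero_mul]).symm
  have e2 : ∀ c : ι → ℝ, ∑ i ∈ H, X i ^ 2 * c i = ∑ i ∈ A, c i := by
    intro c
    rw [← Finset.sum_subset hAH fun i hi h => by rw [hX0 i hi h]; simp]
    exact Finset.sum_congr rfl fun i hi => by rw [hA i hi, one_mul]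
  have e3 : (∑ i ∈ H, ∑ j ∈ H.erase i, X i ^ 2 * X j ^ 2) = (A.card : ℝ) * (A.card - 1) := by
    have : ∀ i ∈ H, ∑ j ∈ H.erase i, X i ^ 2 * X j ^ 2 = X i ^ 2 * (A.card - X i ^ 2) := by
      intro i hi
      rw [← Finset.mul_sum]
      have := e2 fun _ => 1
      simp only [mul_one, Finset.sum_const, nsmul_eq_mul] at this
      rw [← this, ← Finset.add_sum_erase H (fun j => X j ^ 2) hi]
      ring
    rw [Finset.sum_congr rfl this, e2]
    rw [Finset.sum_congr rfl fun i hi => by rw [hA i hi]]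
    simp
    ring
  rw [e1, e2, e2, e3]
  have hs4 : 0 ≤ s ^ 4 := by positivity
  have hsβ : 0 ≤ β + s ^ 2 / β := by positivity
  have hsum0 : 0 ≤ ∑ _i ∈ A, (β + s ^ 2 / β) := Finset.sum_nonneg fun _ _ => hsβ
  -- `A` consists of the heavy entries present in the bucket. With none, only noise remains; with
  -- one, evenness removes its sign and the Lipschitz bound applies; with two or more, the trivial
  -- bound `|A|` is at most the number `|A| (|A| - 1)` of ordered pairs.
  obtain h0 | h1 | h2 : A.card = 0 ∨ A.card = 1 ∨ 2 ≤ A.card := by omega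
  · have : A = ∅ := Finset.card_eq_zero.1 h0
    rw [this]
    simp only [Finset.sum_empty, add_zero, sub_zero, Finset.card_empty, Nat.cast_zero, zero_mul,
      zero_add]
    rw [abs_of_nonneg (hF.nonneg _)]
    exact hF.le_pow_four s
  · obtain ⟨i, hi⟩ := Finset.card_eq_one.1 h1
    have hXi : X i = 1 ∨ X i = -1 := by
      have := hA i (by rw [hi]; simp)
      rcases hX i with h | h | h
      · rw [h] at this; norm_num at this
      · exact Or.inl h
      · exact Or.inr h
    have hFx : F (x i) = F (X i * x i) := by
      rcases hXi with h | h <;> rw [h]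
      · rw [one_mul]
      · rw [neg_one_mul, hF.even]
    rw [hi]
    simp only [Finset.sum_singleton, Finset.card_singleton, Nat.cast_one, sub_self, mul_zero,
      zero_add]
    rw [hFx]
    have h3 := hF.lipschitz (s + X i * x i) (X i * x i)
    rw [add_sub_cancel_right] at h3
    -- This trades `|s|` for `s ^ 2`, whose expectation is known exactly; `β` is tuned later.
    have h4 : |s| ≤ β + s ^ 2 / β := by
      rw [← sub_le_iff_le_add', le_div_iff₀ hβ, ← sq_abs]
      nlinarith [sq_nonneg (β - |s|), abs_nonneg s, mul_nonneg hβ.le (abs_nonneg s)]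
    linarith
  · have hc : (2 : ℝ) ≤ A.card := by exact_mod_cast h2
    have l1 : 0 ≤ ∑ i ∈ A, F (x i) := Finset.sum_nonneg fun i _ => hF.nonneg _
    have l2 : ∑ i ∈ A, F (x i) ≤ A.card := by
      simpa using Finset.sum_le_card_nsmul A (fun i => F (x i)) 1 fun i _ => hF.le_one _
    have l3 := hF.nonneg (s + ∑ i ∈ A, X i * x i)
    have l4 := hF.le_one (s + ∑ i ∈ A, X i * x i)
    have : |F (s + ∑ i ∈ A, X i * x i) - ∑ i ∈ A, F (x i)| ≤ A.card := by
      rw [abs_le]; constructor <;> linarith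
    nlinarith

end IsTestFun

/-! ### Error of hashing and of sampling -/

section Bucket

variable {ι Ξ : Type*} [Fintype ι] [DecidableEq ι] [Fintype Ξ] [Nonempty Ξ]

/-- The expected deviation from additivity in one bucket. -/
lemma expect_bucket_le {F : ℝ → ℝ} (hF : IsTestFun F) (X : Ξ → ℝ)
    (hX : ∀ c, X c = 0 ∨ X c = 1 ∨ X c = -1) (h1 : 𝔼 c, X c = 0) {ρ : ℝ} (h2 : 𝔼 c, X c ^ 2 = ρ)
    (hρ : 0 ≤ ρ) (x : ι → ℝ) {τ β : ℝ} (hτ : 0 < τ) (hτ1 : τ ≤ 1) (hβ : 0 < β) {N T : ℝ}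
    (hN : ((Finset.univ.filter fun i => τ < |x i|).card : ℝ) ≤ N)
    (hT : ∑ i ∈ Finset.univ.filter (fun i => ¬ τ < |x i|), x i ^ 2 ≤ T) :
    𝔼 ω : ι → Ξ, |F (∑ i, X (ω i) * x i) - ∑ i, X (ω i) ^ 2 * F (x i)| ≤
      (ρ * N) ^ 2 + ρ * N * (β + ρ * T / β) + (3 * (ρ * T) ^ 2 + ρ * (τ ^ 2 * T)) := by
  set H := Finset.univ.filter fun i => τ < |x i| with hH
  set A := Finset.univ.filter fun i => ¬ τ < |x i| with hA
  have hT0 : 0 ≤ T := (Finset.sum_nonneg fun i _ => sq_nonneg (x i)).trans hT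
  have hN0 : 0 ≤ N := (Nat.cast_nonneg _).trans hN
  have hX3 : ∀ c, X c ^ 3 = X c := fun c => by rcases hX c with h | h | h <;> rw [h] <;> norm_num
  have hX4 : ∀ c, X c ^ 4 = X c ^ 2 := fun c => by
    rcases hX c with h | h | h <;> rw [h] <;> norm_num
  have split : ∀ ω : ι → Ξ, ∑ i, X (ω i) * x i =
      (∑ i ∈ A, X (ω i) * x i) + ∑ i ∈ H, X (ω i) * x i := fun ω => by
    rw [add_comm, hH, hA, Finset.sum_filter_add_sum_filter_not]
  have split2 : ∀ ω : ι → Ξ, ∑ i, X (ω i) ^ 2 * F (x i) = ∑ i ∈ H, X (ω i) ^ 2 * F (x i) := by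
    intro ω
    symm
    refine Finset.sum_subset (Finset.filter_subset _ _) fun i _ hi => ?_
    have : ¬ τ < |x i| := by simpa [hH] using hi
    rw [hF.eq_zero _ ((not_lt.1 this).trans hτ1), mul_zero]
  have hpt : ∀ ω : ι → Ξ, |F (∑ i, X (ω i) * x i) - ∑ i, X (ω i) ^ 2 * F (x i)| ≤
      (∑ i ∈ H, ∑ j ∈ H.erase i, X (ω i) ^ 2 * X (ω j) ^ 2) +
      (∑ i ∈ H, (β * X (ω i) ^ 2 + β⁻¹ * ((∑ i ∈ A, X (ω i) * x i) ^ 2 * X (ω i) ^ 2))) +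
        (∑ i ∈ A, X (ω i) * x i) ^ 4 := by
    intro ω
    rw [split, split2]
    refine (hF.abs_sub_le (fun i => X (ω i)) (fun i => hX _) x H _ hβ).trans (le_of_eq ?_)
    congr 2
    refine Finset.sum_congr rfl fun i _ => ?_
    field_simp
  refine (Finset.expect_le_expect fun ω _ => hpt ω).trans ?_
  have i1 : ∀ i ∈ H, ∀ j ∈ H.erase i, 𝔼 ω : ι → Ξ, X (ω i) ^ 2 * X (ω j) ^ 2 = ρ ^ 2 := by
    intro i _ j hj
    rw [expect_mul_two_coords (Finset.ne_of_mem_erase hj).symm (fun c => X c ^ 2)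
      (fun c => X c ^ 2), h2, sq]
  have i2 : ∀ i : ι, 𝔼 ω : ι → Ξ, X (ω i) ^ 2 = ρ := fun i => by
    rw [expect_coord i (fun c => X c ^ 2), h2]
  -- The noise involves only light coordinates, so it is independent of the heavy coordinate `i`.
  have i3 : ∀ i ∈ H, 𝔼 ω : ι → Ξ, (∑ i ∈ A, X (ω i) * x i) ^ 2 * X (ω i) ^ 2 =
      (ρ * ∑ i ∈ A, x i ^ 2) * ρ := by
    intro i hi
    have hiA : i ∉ A := by
      simp only [hA, Finset.mem_filter, not_and, not_not]
      exact fun _ => (Finset.mem_filter.1 hi).2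
    rw [expect_mul_coord i (fun ω : ι → Ξ => (∑ i ∈ A, X (ω i) * x i) ^ 2)
      (fun ω c => by
        have := sum_update_eq hiA (fun j y => X y * x j) ω c
        simp only [this]) (fun c => X c ^ 2), h2, expect_sq_sum X h1 x A, h2]
  have i4 := expect_pow_four_sum_le X h1 (by simp only [hX3, h1]) (by simp only [hX4]) x A
  rw [h2] at i4
  have hx4 : ∑ i ∈ A, x i ^ 4 ≤ τ ^ 2 * T := by
    calc ∑ i ∈ A, x i ^ 4 ≤ ∑ i ∈ A, τ ^ 2 * x i ^ 2 := by
          refine Finset.sum_le_sum fun i hi => ?_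
          have h : |x i| ≤ τ := not_lt.1 (Finset.mem_filter.1 hi).2
          have : x i ^ 2 ≤ τ ^ 2 := by rw [← sq_abs]; nlinarith [abs_nonneg (x i)]
          nlinarith [sq_nonneg (x i)]
      _ = τ ^ 2 * ∑ i ∈ A, x i ^ 2 := by rw [Finset.mul_sum]
      _ ≤ _ := mul_le_mul_of_nonneg_left hT (sq_nonneg _)
  have hS0 : 0 ≤ ∑ i ∈ A, x i ^ 2 := Finset.sum_nonneg fun i _ => sq_nonneg (x i)
  simp only [Finset.expect_add_distrib, Finset.expect_sum_comm, ← Finset.mul_expect]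
  gcongr ?_ + ?_ + ?_
  · rw [Finset.sum_congr rfl fun i hi => Finset.sum_congr rfl fun j hj => i1 i hi j hj]
    simp only [Finset.sum_const, nsmul_eq_mul]
    rw [Finset.sum_congr rfl (g := fun _ => ((H.card - 1 : ℕ) : ℝ) * ρ ^ 2) fun i hi => by
      rw [Finset.card_erase_of_mem hi]]
    simp only [Finset.sum_const, nsmul_eq_mul]
    have : ((H.card - 1 : ℕ) : ℝ) ≤ H.card := by exact_mod_cast Nat.sub_le _ _
    have h3 : (H.card : ℝ) * ((H.card - 1 : ℕ) : ℝ) ≤ N * N := by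
      apply mul_le_mul hN (this.trans hN) (by positivity) hN0
    nlinarith [sq_nonneg ρ]
  · rw [Finset.sum_congr rfl fun i hi => by rw [i2, i3 i hi]]
    simp only [Finset.sum_const, nsmul_eq_mul]
    have : β * ρ + β⁻¹ * ((ρ * ∑ i ∈ A, x i ^ 2) * ρ) ≤ ρ * (β + ρ * T / β) := by
      have : β⁻¹ * ((ρ * ∑ i ∈ A, x i ^ 2) * ρ) ≤ β⁻¹ * ((ρ * T) * ρ) := by gcongr
      calc _ ≤ β * ρ + β⁻¹ * ((ρ * T) * ρ) := by linarith
        _ = _ := by field_simp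
    calc _ ≤ N * (ρ * (β + ρ * T / β)) := by
          apply mul_le_mul hN this (by positivity) hN0
      _ = _ := by ring
  · refine i4.trans ?_
    gcongr

/-- The expected deviation from additivity, summed over `B` buckets. -/
lemma expect_buckets_le {F : ℝ → ℝ} (hF : IsTestFun F) {B : ℕ} (X : Fin B → Ξ → ℝ)
    (hX : ∀ b c, X b c = 0 ∨ X b c = 1 ∨ X b c = -1) (h1 : ∀ b, 𝔼 c, X b c = 0) {q : ℝ}
    (hq : 0 ≤ q) (h2 : ∀ b, 𝔼 c, X b c ^ 2 = q / B) (x : ι → ℝ) {Λ Z : ℝ} (hΛ : 1 ≤ Λ)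
    (hZ : 1 ≤ Z) (hB : 200 * Λ ^ 5 * Z ^ 4 ≤ B)
    (hx : q * ∑ i, min (x i ^ 2) 1 ≤ Λ) :
    𝔼 ω : ι → Ξ, |∑ b, F (∑ i, X b (ω i) * x i) - ∑ i, (∑ b, X b (ω i) ^ 2) * F (x i)| ≤ 1 / Z := by
  have hB0 : (0 : ℝ) < B := lt_of_lt_of_le (by positivity) hB
  -- The two error terms without a factor `1 / B` are `t * (q * T)` and `(q * N) * β`. Each is at
  -- most `1 / (4 * Z)` by the choice of `t` and `β`, since `q * T ≤ Λ` and `q * N ≤ Λ / t`; the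
  -- size of `B` takes care of the rest.
  set t : ℝ := 1 / (4 * Λ * Z) with ht
  have ht0 : 0 < t := by positivity
  have hΛZ : 1 ≤ Λ * Z := one_le_mul_of_one_le_of_one_le hΛ hZ
  have ht1 : t ≤ 1 := by
    rw [ht, div_le_one (by positivity)]; nlinarith
  set τ := Real.sqrt t
  have hτ2 : τ ^ 2 = t := Real.sq_sqrt ht0.le
  have hτ0 : 0 < τ := Real.sqrt_pos.2 ht0
  have hτ1 : τ ≤ 1 := Real.sqrt_le_one.2 ht1
  set β : ℝ := 1 / (16 * Λ ^ 2 * Z ^ 2) with hβ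
  have hβ0 : 0 < β := by positivity
  set H := Finset.univ.filter fun i => τ < |x i|
  set A := Finset.univ.filter fun i => ¬ τ < |x i|
  set N : ℝ := (H.card : ℝ)
  set T : ℝ := ∑ i ∈ A, x i ^ 2
  have hN0 : 0 ≤ N := Nat.cast_nonneg _
  have hT0 : 0 ≤ T := Finset.sum_nonneg fun i _ => sq_nonneg _
  have hNT : t * N + T ≤ ∑ i, min (x i ^ 2) 1 := by
    rw [← Finset.sum_filter_add_sum_filter_not Finset.univ fun i => τ < |x i|]
    gcongr ?_ + ?_
    · have : ∀ i ∈ H, t ≤ min (x i ^ 2) 1 := by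
        intro i hi
        have h : τ < |x i| := (Finset.mem_filter.1 hi).2
        refine le_min ?_ ht1
        rw [← hτ2, ← sq_abs (x i)]; nlinarith
      have := Finset.card_nsmul_le_sum H _ t this
      rw [nsmul_eq_mul] at this
      linarith [mul_comm t N]
    · refine Finset.sum_le_sum fun i hi => ?_
      have h : |x i| ≤ τ := not_lt.1 (Finset.mem_filter.1 hi).2
      refine le_min le_rfl ?_
      rw [← sq_abs]; nlinarith [abs_nonneg (x i)]
  have hqN : q * N ≤ 4 * Λ ^ 2 * Z := by
    have : q * (t * N) ≤ Λ := by nlinarith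
    have : t * (q * N) ≤ Λ := by linarith
    rw [ht, div_mul_eq_mul_div, one_mul, div_le_iff₀ (by positivity)] at this
    linarith
  have hqT : q * T ≤ Λ := by
    have : 0 ≤ t * N := by positivity
    nlinarith
  have hbucket : ∀ b, 𝔼 ω : ι → Ξ, |F (∑ i, X b (ω i) * x i) - ∑ i, X b (ω i) ^ 2 * F (x i)| ≤
      (1 / Z) / B := by
    intro b
    refine (expect_bucket_le hF (X b) (hX b) (h1 b) (h2 b) (by positivity) x hτ0 hτ1 hβ0 (N := N)
      (T := T) le_rfl le_rfl).trans ?_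
    rw [le_div_iff₀ hB0, hτ2]
    have e : ((q / B * N) ^ 2 + q / B * N * (β + q / B * T / β) +
        (3 * (q / B * T) ^ 2 + q / B * (t * T))) * B =
        (q * N) ^ 2 / B + (q * N) * (β + (q * T) / β / B) + (3 * (q * T) ^ 2 / B + t * (q * T)) := by
      field_simp
    rw [e]
    have hqN0 : 0 ≤ q * N := by positivity
    have hqT0 : 0 ≤ q * T := by positivity
    calc _ ≤ (4 * Λ ^ 2 * Z) ^ 2 / B + (4 * Λ ^ 2 * Z) * (β + Λ / β / B) + (3 * Λ ^ 2 / B + t * Λ) := by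
          gcongr
      _ = 1 / (2 * Z) + (16 * Λ ^ 4 * Z ^ 2 + 64 * Λ ^ 5 * Z ^ 3 + 3 * Λ ^ 2) / B := by
          rw [hβ, ht]; field_simp; ring
      _ ≤ 1 / (2 * Z) + 1 / (2 * Z) := by
          gcongr 1 / (2 * Z) + ?_
          rw [div_le_div_iff₀ hB0 (by positivity)]
          have a1 : Λ ^ 4 * Z ^ 3 ≤ Λ ^ 5 * Z ^ 4 := by gcongr <;> norm_num
          have a3 : Λ ^ 2 * Z ≤ Λ ^ 5 * Z ^ 4 := by
            calc Λ ^ 2 * Z = Λ ^ 2 * Z ^ 1 := by ring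
              _ ≤ _ := by gcongr <;> norm_num
          nlinarith
      _ = 1 / Z := by field_simp; norm_num
  have hpt : ∀ ω : ι → Ξ,
      |∑ b, F (∑ i, X b (ω i) * x i) - ∑ i, (∑ b, X b (ω i) ^ 2) * F (x i)| ≤
        ∑ b, |F (∑ i, X b (ω i) * x i) - ∑ i, X b (ω i) ^ 2 * F (x i)| := by
    intro ω
    have : ∑ i, (∑ b, X b (ω i) ^ 2) * F (x i) = ∑ b, ∑ i, X b (ω i) ^ 2 * F (x i) := by
      simp only [Finset.sum_mul]; exact Finset.sum_comm
    rw [this, ← Finset.sum_sub_distrib]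
    exact Finset.abs_sum_le_sum_abs _ _
  refine (Finset.expect_le_expect fun ω _ => hpt ω).trans ?_
  rw [Finset.expect_sum_comm]
  refine (Finset.sum_le_sum fun b _ => hbucket b).trans ?_
  simp only [Finset.sum_const, Finset.card_univ, Fintype.card_fin, nsmul_eq_mul]
  rw [mul_div_cancel₀ _ hB0.ne']

/-- The probability that the buckets misrepresent the test function `F`. -/
lemma card_bad_buckets_le {F : ℝ → ℝ} (hF : IsTestFun F) {B : ℕ} (X : Fin B → Ξ → ℝ)
    (hX : ∀ b c, X b c = 0 ∨ X b c = 1 ∨ X b c = -1) (h1 : ∀ b, 𝔼 c, X b c = 0) {q : ℝ}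
    (hq : 0 ≤ q) (h2 : ∀ b, 𝔼 c, X b c ^ 2 = q / B)
    (hI : ∀ c, ∑ b, X b c ^ 2 = 0 ∨ ∑ b, X b c ^ 2 = 1)
    (hq1 : (q = 1 ∧ ∀ c, ∑ b, X b c ^ 2 = 1) ∨ q ≤ 1 / 2) (x : ι → ℝ) {Λ Z η₀ η₁ : ℝ}
    (hΛ : 1 ≤ Λ) (hZ : 1 ≤ Z) (hB : 200 * Λ ^ 5 * Z ^ 4 ≤ B) (hη₀ : 0 < η₀) (hη₁ : 0 < η₁)
    (hx : q * ∑ i, min (x i ^ 2) 1 ≤ Λ)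
    [DecidablePred fun ω : ι → Ξ =>
      ¬ |∑ b, F (∑ i, X b (ω i) * x i) - q * ∑ i, F (x i)| ≤ η₀ + (1 - q) * η₁] :
    ((Finset.univ.filter fun ω : ι → Ξ =>
      ¬ |∑ b, F (∑ i, X b (ω i) * x i) - q * ∑ i, F (x i)| ≤ η₀ + (1 - q) * η₁).card : ℝ) ≤
        (1 / (Z * η₀) + 2 * Λ / η₁ ^ 2) * Fintype.card (ι → Ξ) := by
  classical
  have hB0 : (0 : ℝ) < B := lt_of_lt_of_le (by positivity) hB
  set I : Ξ → ℝ := fun c => ∑ b, X b c ^ 2 with hIdef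
  -- `D` is the error from collisions among the sampled coordinates, `V` the error from the sampling
  -- itself.
  set D : (ι → Ξ) → ℝ := fun ω => ∑ b, F (∑ i, X b (ω i) * x i) - ∑ i, I (ω i) * F (x i)
  set V : (ι → Ξ) → ℝ := fun ω => ∑ i, (I (ω i) - q) * F (x i)
  set Bad₀ := Finset.univ.filter fun ω : ι → Ξ => η₀ ≤ |D ω|
  set Bad₁ := Finset.univ.filter fun ω : ι → Ξ => (1 - q) * η₁ < |V ω|
  have hsub : (Finset.univ.filter fun ω : ι → Ξ =>
      ¬ |∑ b, F (∑ i, X b (ω i) * x i) - q * ∑ i, F (x i)| ≤ η₀ + (1 - q) * η₁) ⊆ Bad₀ ∪ Bad₁ := by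
    intro ω hω
    have hω := (Finset.mem_filter.1 hω).2
    simp only [Bad₀, Bad₁, Finset.mem_union, Finset.mem_filter, Finset.mem_univ, true_and]
    by_contra h
    push Not at h
    apply hω
    have e : ∑ b, F (∑ i, X b (ω i) * x i) - q * ∑ i, F (x i) = D ω + V ω := by
      simp only [D, V, sub_mul, Finset.sum_sub_distrib, Finset.mul_sum]; ring
    rw [e]
    exact (abs_add_le _ _).trans (by linarith [h.1, h.2])
  have hD : (Bad₀.card : ℝ) ≤ 1 / (Z * η₀) * Fintype.card (ι → Ξ) := by
    have h := card_filter_le_of_expect (fun ω => |D ω|) (fun ω => abs_nonneg _)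
      (fun ω => η₀ ≤ |D ω|) (a := η₀) (fun ω h => h)
    have h3 := expect_buckets_le hF X hX h1 hq h2 x hΛ hZ hB hx
    have h4 : η₀ * (Bad₀.card : ℝ) ≤ 1 / Z * Fintype.card (ι → Ξ) :=
      h.trans (mul_le_mul_of_nonneg_right h3 (Nat.cast_nonneg _))
    calc (Bad₀.card : ℝ) = (η₀ * (Bad₀.card : ℝ)) / η₀ := by field_simp
      _ ≤ (1 / Z * Fintype.card (ι → Ξ)) / η₀ := by gcongr
      _ = _ := by field_simp
  have hV : (Bad₁.card : ℝ) ≤ 2 * Λ / η₁ ^ 2 * Fintype.card (ι → Ξ) := by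
    -- At rate 1 there is no sampling error. Otherwise the variance carries a factor `1 - q` and the
    -- squared tolerance `(1 - q) ^ 2`, so Chebyshev loses `1 / (1 - q) ≤ 2`.
    rcases hq1 with ⟨hq1, hI1⟩ | hq1
    · have : Bad₁ = ∅ := by
        refine Finset.filter_eq_empty_iff.2 fun ω _ => ?_
        have : V ω = 0 := Finset.sum_eq_zero fun i _ => by
          have := hI1 (ω i)
          simp only [hIdef, this, hq1, sub_self, zero_mul]
        rw [this, hq1]; simp
      rw [this]; simp; positivity
    · have hEI : 𝔼 c, I c = q := by
        simp only [hIdef]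
        rw [Finset.expect_sum_comm, Finset.sum_congr rfl fun b _ => h2 b]
        simp; field_simp
      have hI2 : ∀ c, (I c - q) ^ 2 = (1 - 2 * q) * I c + q ^ 2 := by
        intro c
        rcases hI c with h | h <;> simp only [hIdef, h] <;> ring
      have hEV : 𝔼 c, (I c - q) ^ 2 = q * (1 - q) := by
        simp only [hI2, Finset.expect_add_distrib, ← Finset.mul_expect, hEI,
          Fintype.expect_const]
        ring
      have h3 := expect_sq_sum (fun c => I c - q)
        (by rw [Finset.expect_sub_distrib, hEI, Fintype.expect_const, sub_self])
        (fun i => F (x i)) Finset.univ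
      have hF2 : q * ∑ i, F (x i) ^ 2 ≤ Λ :=
        (mul_le_mul_of_nonneg_left (Finset.sum_le_sum fun i _ => hF.sq_le_min (x i)) hq).trans hx
      have hS0 : 0 ≤ ∑ i, F (x i) ^ 2 := Finset.sum_nonneg fun i _ => sq_nonneg _
      have h := card_filter_le_of_expect (fun ω => V ω ^ 2) (fun ω => sq_nonneg _)
        (fun ω => (1 - q) * η₁ < |V ω|) (a := ((1 - q) * η₁) ^ 2) (fun ω h => by
          rw [← sq_abs (V ω)]
          have : 0 ≤ (1 - q) * η₁ := mul_nonneg (by linarith) hη₁.le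
          nlinarith)
      have h4 : ((1 - q) * η₁) ^ 2 * (Bad₁.card : ℝ) ≤ (1 - q) * Λ * Fintype.card (ι → Ξ) := by
        refine h.trans (mul_le_mul_of_nonneg_right ?_ (Nat.cast_nonneg _))
        refine (le_of_eq h3).trans ?_
        rw [hEV]
        nlinarith
      have h5 : (1 - q) * η₁ ^ 2 * (Bad₁.card : ℝ) ≤ Λ * Fintype.card (ι → Ξ) := by
        have : 0 < 1 - q := by linarith
        have : (1 - q) * ((1 - q) * η₁ ^ 2 * (Bad₁.card : ℝ)) ≤
            (1 - q) * (Λ * Fintype.card (ι → Ξ)) := by linarith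
        exact le_of_mul_le_mul_left this ‹_›
      have h6 : η₁ ^ 2 * (Bad₁.card : ℝ) ≤ 2 * Λ * Fintype.card (ι → Ξ) := by
        have : 0 ≤ η₁ ^ 2 * (Bad₁.card : ℝ) := by positivity
        nlinarith
      calc (Bad₁.card : ℝ) = (η₁ ^ 2 * (Bad₁.card : ℝ)) / η₁ ^ 2 := by field_simp
        _ ≤ (2 * Λ * Fintype.card (ι → Ξ)) / η₁ ^ 2 := by gcongr
        _ = _ := by field_simp
  calc _ ≤ ((Bad₀ ∪ Bad₁).card : ℝ) := by exact_mod_cast Finset.card_le_card hsub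
    _ ≤ (Bad₀.card : ℝ) + Bad₁.card := by exact_mod_cast Finset.card_union_le _ _
    _ ≤ _ := by rw [add_mul]; gcongr

end Bucket

/-! ### Dyadic pieces of the truncated power -/

section Piece

/-- The truncated power `(w ^ p - t)₊`. -/
noncomputable def excess (p t w : ℝ) : ℝ := max (w ^ p - t) 0

/-- The part of `excess p t |u|` accumulated while `|u|` passes from `v` to `2 v`. -/
noncomputable def piece (p t v u : ℝ) : ℝ :=
  excess p t (min |u| (2 * v)) - excess p t (min |u| v)

variable {p t v : ℝ}

lemma excess_nonneg (w : ℝ) : 0 ≤ excess p t w := le_max_right _ _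

lemma excess_mono (hp : 0 ≤ p) {a b : ℝ} (ha : 0 ≤ a) (hab : a ≤ b) :
    excess p t a ≤ excess p t b :=
  max_le_max (sub_le_sub_right (Real.rpow_le_rpow ha hab hp) _) le_rfl

lemma excess_eq_zero {w : ℝ} (h : w ^ p ≤ t) : excess p t w = 0 :=
  max_eq_right (sub_nonpos.2 h)

lemma piece_eq_zero (hv : 0 < v) {u : ℝ} (h : |u| ≤ v) : piece p t v u = 0 := by
  rw [piece, min_eq_left h, min_eq_left (by linarith), sub_self]

/-- Only the clamp of `|u|` to `[v, 2 v]` matters; clamping is 1-Lipschitz, and on that interval the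
power has a controlled slope. -/
lemma piece_eq_clamp (hv : 0 < v) (u : ℝ) :
    piece p t v u = excess p t (max v (min |u| (2 * v))) - excess p t v := by
  rcases le_total |u| v with h | h
  · rw [piece_eq_zero hv h, min_eq_left (by linarith), max_eq_left h, sub_self]
  · rw [piece, min_eq_right h, max_eq_right (le_min h (by linarith))]

/-- Since `a / b ≥ 1` and `p ≤ 2`, the power is compared with the square, where the difference
factors. -/
lemma rpow_sub_rpow_le (hp2 : p ≤ 2) (hv : 0 < v) {a b : ℝ} (hb : v ≤ b) (hab : b ≤ a)
    (ha : a ≤ 2 * v) : a ^ p - b ^ p ≤ 4 * v ^ p / v * (a - b) := by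
  have hb0 : 0 < b := hv.trans_le hb
  have h1 : (a / b) ^ p ≤ (a / b) ^ (2 : ℝ) :=
    Real.rpow_le_rpow_of_exponent_le ((one_le_div hb0).2 hab) hp2
  rw [Real.div_rpow (by linarith) hb0.le, div_le_iff₀ (Real.rpow_pos_of_pos hb0 p),
    Real.rpow_two] at h1
  have h2 : b ^ (p - 2) ≤ v ^ (p - 2) := Real.rpow_le_rpow_of_nonpos hv hb (by linarith)
  rw [Real.rpow_sub hb0, Real.rpow_sub hv, Real.rpow_two, Real.rpow_two] at h2
  calc a ^ p - b ^ p ≤ (a / b) ^ 2 * b ^ p - b ^ p := by linarith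
    _ = b ^ p / b ^ 2 * ((a + b) * (a - b)) := by field_simp; ring
    _ ≤ v ^ p / v ^ 2 * ((4 * v) * (a - b)) := by
        have h3 : 0 ≤ a - b := by linarith
        exact mul_le_mul h2 (mul_le_mul_of_nonneg_right (by linarith) h3)
          (mul_nonneg (by linarith) h3) (by positivity)
    _ = _ := by field_simp

lemma two_mul_rpow_le (hp2 : p ≤ 2) (hv : 0 < v) : (2 * v) ^ p ≤ 4 * v ^ p := by
  rw [Real.mul_rpow (by norm_num) hv.le]
  have : (2 : ℝ) ^ p ≤ 2 ^ (2 : ℝ) := Real.rpow_le_rpow_of_exponent_le (by norm_num) hp2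
  have h4 : (2 : ℝ) ^ (2 : ℝ) = 4 := by norm_num
  gcongr
  linarith

lemma abs_piece_sub_le (hp1 : 1 ≤ p) (hp2 : p ≤ 2) (hv : 0 < v) (u w : ℝ) :
    |piece p t v u - piece p t v w| ≤ 4 * v ^ p / v * |u - w| := by
  rw [piece_eq_clamp hv, piece_eq_clamp hv, sub_sub_sub_cancel_right]
  set a := max v (min |u| (2 * v))
  set b := max v (min |w| (2 * v))
  have ha : v ≤ a := le_max_left _ _
  have hb : v ≤ b := le_max_left _ _
  have ha2 : a ≤ 2 * v := max_le (by linarith) (min_le_right _ _)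
  have hb2 : b ≤ 2 * v := max_le (by linarith) (min_le_right _ _)
  have hab : |a - b| ≤ |u - w| :=
    calc |a - b| ≤ |min |u| (2 * v) - min |w| (2 * v)| := by
          refine (abs_max_sub_max_le_max _ _ _ _).trans (le_of_eq ?_)
          rw [sub_self, abs_zero, max_eq_right (abs_nonneg _)]
      _ ≤ |(|u| - |w|)| := by
          refine (abs_min_sub_min_le_max _ _ _ _).trans (le_of_eq ?_)
          rw [sub_self, abs_zero, max_eq_left (abs_nonneg _)]
      _ ≤ |u - w| := abs_abs_sub_abs_le _ _
  have h1 : |excess p t a - excess p t b| ≤ |a ^ p - b ^ p| := by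
    refine (abs_max_sub_max_le_abs _ _ _).trans (le_of_eq ?_)
    congr 1; ring
  have h2 : |a ^ p - b ^ p| ≤ 4 * v ^ p / v * |a - b| := by
    have hvp := Real.rpow_pos_of_pos hv p
    rcases le_total b a with h | h
    · rw [abs_of_nonneg (sub_nonneg.2 h), abs_of_nonneg (sub_nonneg.2
        (Real.rpow_le_rpow (by linarith) h (by linarith)))]
      exact rpow_sub_rpow_le hp2 hv hb h ha2
    · rw [abs_sub_comm, abs_sub_comm a, abs_of_nonneg (sub_nonneg.2 h), abs_of_nonneg (sub_nonneg.2
        (Real.rpow_le_rpow (by linarith) h (by linarith)))]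
      exact rpow_sub_rpow_le hp2 hv ha h hb2
  have hvp := Real.rpow_pos_of_pos hv p
  exact h1.trans (h2.trans (by gcongr))

lemma piece_nonneg (hp : 0 ≤ p) (hv : 0 < v) (u : ℝ) : 0 ≤ piece p t v u :=
  sub_nonneg.2 (excess_mono hp (le_min (abs_nonneg _) hv.le)
    (min_le_min le_rfl (by linarith)))

lemma piece_eq_zero_of_le (hp : 0 ≤ p) (hv : 0 < v) (h : (2 * v) ^ p ≤ t) (u : ℝ) :
    piece p t v u = 0 := by
  refine le_antisymm ?_ (piece_nonneg hp hv u)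
  rw [piece, excess_eq_zero (w := min |u| (2 * v)), zero_sub]
  · exact neg_nonpos.2 (excess_nonneg _)
  · exact (Real.rpow_le_rpow (le_min (abs_nonneg _) (by linarith)) (min_le_right _ _) hp).trans h

lemma piece_le (hp1 : 1 ≤ p) (hp2 : p ≤ 2) (ht : 0 ≤ t) (hv : 0 < v) (u : ℝ) :
    piece p t v u ≤ 4 * v ^ p := by
  have h1 : excess p t (min |u| (2 * v)) ≤ (2 * v) ^ p := by
    refine max_le ?_ (Real.rpow_nonneg (by linarith) _)
    have : (min |u| (2 * v)) ^ p ≤ (2 * v) ^ p :=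
      Real.rpow_le_rpow (le_min (abs_nonneg _) (by linarith)) (min_le_right _ _) (by linarith)
    linarith
  have h2 := excess_nonneg (p := p) (t := t) (min |u| v)
  have h3 := two_mul_rpow_le hp2 hv
  rw [piece]
  linarith

/-- The normalisation `4 * v ^ p` is at once a bound for the piece and `v` times its Lipschitz
constant. -/
lemma isTestFun_piece (hp1 : 1 ≤ p) (hp2 : p ≤ 2) (ht : 0 ≤ t) (hv : 0 < v) :
    IsTestFun fun u => piece p t v (v * u) / (4 * v ^ p) := by
  have hvp := Real.rpow_pos_of_pos hv p
  refine ⟨fun u => ?_, fun u => ?_, fun u hu => ?_, fun u => ?_, fun u w => ?_⟩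
  · have := piece_nonneg (t := t) (by linarith : 0 ≤ p) hv (v * u)
    positivity
  · rw [div_le_one (by positivity)]
    exact piece_le hp1 hp2 ht hv _
  · rw [piece_eq_zero hv, zero_div]
    rw [abs_mul, abs_of_pos hv]
    nlinarith
  · simp [piece]
  · rw [← sub_div, abs_div, abs_of_pos (by positivity : 0 < 4 * v ^ p), div_le_iff₀ (by positivity)]
    refine (abs_piece_sub_le hp1 hp2 hv _ _).trans (le_of_eq ?_)
    rw [← mul_sub, abs_mul, abs_of_pos hv]
    field_simp

/-- The pieces at dyadic scales add up to the excess. -/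
lemma sum_piece (hp : 0 ≤ p) (hv : 0 < v) (hvt : v ^ p ≤ t) (S : ℕ) {u : ℝ}
    (hu : |u| ≤ v * 2 ^ S) :
    ∑ s ∈ Finset.range S, piece p t (v * 2 ^ s) u = excess p t |u| := by
  have h : ∀ s, piece p t (v * 2 ^ s) u =
      excess p t (min |u| (v * 2 ^ (s + 1))) - excess p t (min |u| (v * 2 ^ s)) := by
    intro s
    rw [piece, show 2 * (v * 2 ^ s) = v * 2 ^ (s + 1) by ring]
  simp only [h]
  rw [Finset.sum_range_sub (fun s => excess p t (min |u| (v * 2 ^ s))), min_eq_left hu, pow_zero,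
    mul_one, excess_eq_zero (w := min |u| v), sub_zero]
  exact (Real.rpow_le_rpow (le_min (abs_nonneg _) hv.le) (min_le_right _ _) hp).trans hvt

end Piece

/-! ### The random matrix: signs, nested sampling, buckets -/

section Entries

/-- The randomness attached to one coordinate: a sign, a number that decides on which levels the
coordinate is sampled, and a bucket. -/
abbrev Cell (W B : ℕ) : Type := Bool × Fin (2 ^ W) × Fin B

/-- The entry of the sketching matrix in bucket `b` of level `l`, where coordinates are sampled with
probability `2 ^ (-l)`. -/
def cellEntry {W B : ℕ} (l : ℕ) (b : Fin B) (c : Cell W B) : ℤ :=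
  if c.2.2 = b ∧ (c.2.1 : ℕ) < 2 ^ (W - l) then (if c.1 then 1 else -1) else 0

variable {W B : ℕ}

lemma cellEntry_cases (l : ℕ) (b : Fin B) (c : Cell W B) :
    cellEntry l b c = 0 ∨ cellEntry l b c = 1 ∨ cellEntry l b c = -1 := by
  unfold cellEntry
  split_ifs <;> simp

lemma cellEntry_sq (l : ℕ) (b : Fin B) (c : Cell W B) :
    ((cellEntry l b c : ℤ) : ℝ) ^ 2 =
      if c.2.2 = b then (if (c.2.1 : ℕ) < 2 ^ (W - l) then 1 else 0) else 0 := by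
  unfold cellEntry
  by_cases h1 : c.2.2 = b <;> by_cases h2 : (c.2.1 : ℕ) < 2 ^ (W - l) <;> by_cases h3 : c.1 = true <;>
    simp [h1, h2, h3]

lemma sum_cellEntry_sq (l : ℕ) (c : Cell W B) :
    ∑ b, ((cellEntry l b c : ℤ) : ℝ) ^ 2 = if (c.2.1 : ℕ) < 2 ^ (W - l) then 1 else 0 := by
  simp only [cellEntry_sq, Finset.sum_ite_eq, Finset.mem_univ, if_true]

lemma expect_cellEntry (l : ℕ) (b : Fin B) :
    𝔼 c : Cell W B, ((cellEntry l b c : ℤ) : ℝ) = 0 := by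
  rw [Fintype.expect_eq_sum_div_card, Fintype.sum_prod_type]
  simp only [Fintype.sum_bool, cellEntry, if_true]
  rw [← Finset.sum_add_distrib, Finset.sum_eq_zero, zero_div]
  intro c _
  split_ifs <;> simp_all

lemma expect_cellEntry_sq {l : ℕ} (hl : l ≤ W) (hB : 0 < B) (b : Fin B) :
    𝔼 c : Cell W B, ((cellEntry l b c : ℤ) : ℝ) ^ 2 = (1 / 2) ^ l / B := by
  rw [Fintype.expect_eq_sum_div_card]
  have h : ∑ x : Fin (2 ^ W), (if (x : ℕ) < 2 ^ (W - l) then (1 : ℝ) else 0) = 2 ^ (W - l) := by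
    have hle : 2 ^ (W - l) ≤ 2 ^ W := Nat.pow_le_pow_right (by norm_num) (Nat.sub_le _ _)
    rw [Fin.sum_univ_eq_sum_range (fun x => if x < 2 ^ (W - l) then (1 : ℝ) else 0) (2 ^ W),
      ← Finset.sum_filter]
    have : (Finset.range (2 ^ W)).filter (fun x => x < 2 ^ (W - l)) = Finset.range (2 ^ (W - l)) := by
      ext x; simp only [Finset.mem_filter, Finset.mem_range]; omega
    rw [this]; simp
  have e : ∑ c : Cell W B, ((cellEntry l b c : ℤ) : ℝ) ^ 2 = ∑ _a : Bool, 2 ^ (W - l) := by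
    rw [Fintype.sum_prod_type]
    refine Finset.sum_congr rfl fun a _ => ?_
    rw [← h, Fintype.sum_prod_type]
    exact Finset.sum_congr rfl fun y _ => by simp [cellEntry_sq]
  rw [e]
  have hBr : (B : ℝ) ≠ 0 := by exact_mod_cast hB.ne'
  have hW : (2 : ℝ) ^ W = 2 ^ (W - l) * 2 ^ l := by rw [← pow_add, Nat.sub_add_cancel hl]
  simp only [Fintype.card_prod, Fintype.card_bool, Fintype.card_fin, Finset.sum_const,
    Finset.card_univ, nsmul_eq_mul]
  push_cast
  rw [hW]
  field_simp
  simp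

/-- The content of bucket `b` of level `l`. -/
def bucketVal {n : ℕ} (ω : Fin n → Cell W B) (l : ℕ) (b : Fin B) (x : Fin n → ℤ) : ℤ :=
  ∑ i, cellEntry l b (ω i) * x i

/-- For a light input, a piece is estimated well by the buckets with high probability. -/
lemma card_bad_piece_le [NeZero B] {n : ℕ} {p t v : ℝ} (hp1 : 1 ≤ p) (hp2 : p ≤ 2) (ht : 0 ≤ t)
    (hv : 0 < v) {l : ℕ} (hl : l ≤ W) (x : Fin n → ℤ) {Λ Z η₀ η₁ : ℝ}
    (hΛ : 1 ≤ Λ) (hZ : 1 ≤ Z) (hB : 200 * Λ ^ 5 * Z ^ 4 ≤ B) (hη₀ : 0 < η₀) (hη₁ : 0 < η₁)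
    (hx : (1 / 2) ^ l * ∑ i, min ((x i : ℝ) ^ 2) (v ^ 2) ≤ Λ * v ^ 2)
    [DecidablePred fun ω : Fin n → Cell W B =>
      ¬ |∑ b, piece p t v (bucketVal ω l b x) - (1 / 2) ^ l * ∑ i, piece p t v (x i)| ≤
        4 * v ^ p * (η₀ + (1 - (1 / 2) ^ l) * η₁)] :
    ((Finset.univ.filter fun ω : Fin n → Cell W B =>
      ¬ |∑ b, piece p t v (bucketVal ω l b x) - (1 / 2) ^ l * ∑ i, piece p t v (x i)| ≤
        4 * v ^ p * (η₀ + (1 - (1 / 2) ^ l) * η₁)).card : ℝ) ≤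
      (1 / (Z * η₀) + 2 * Λ / η₁ ^ 2) * Fintype.card (Fin n → Cell W B) := by
  classical
  have hvp := Real.rpow_pos_of_pos hv p
  have hv2 : 0 < v ^ 2 := by positivity
  have hB0 : 0 < B := Nat.pos_of_ne_zero (NeZero.ne B)
  have h := card_bad_buckets_le (ι := Fin n) (isTestFun_piece hp1 hp2 ht hv)
    (fun b (c : Cell W B) => ((cellEntry l b c : ℤ) : ℝ))
    (fun b c => by rcases cellEntry_cases l b c with h | h | h <;> simp [h])
    (expect_cellEntry l) (q := (1 / 2) ^ l) (by positivity) (expect_cellEntry_sq hl hB0)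
    (fun c => by rw [sum_cellEntry_sq]; split_ifs <;> simp)
    (by
      rcases Nat.eq_zero_or_pos l with h0 | h0
      · left
        refine ⟨by simp [h0], fun c => ?_⟩
        rw [sum_cellEntry_sq, h0, Nat.sub_zero, if_pos c.2.1.2]
      · right
        calc ((1 : ℝ) / 2) ^ l ≤ (1 / 2) ^ 1 :=
              pow_le_pow_of_le_one (by norm_num) (by norm_num) h0
          _ = 1 / 2 := pow_one _)
    (fun i => (x i : ℝ) / v) hΛ hZ hB hη₀ hη₁
    (by
      have e : ∀ i, min (((x i : ℝ) / v) ^ 2) 1 = min ((x i : ℝ) ^ 2) (v ^ 2) / v ^ 2 := by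
        intro i
        rw [div_pow, ← min_div_div_right hv2.le, div_self hv2.ne']
      simp only [e]
      rw [← Finset.sum_div, ← mul_div_assoc, div_le_iff₀ hv2]
      exact hx)
  refine le_trans (le_of_eq ?_) h
  congr 2
  refine Finset.filter_congr fun ω _ => not_congr ?_
  have e1 : ∀ b, v * ∑ i, ((cellEntry l b (ω i) : ℤ) : ℝ) * ((x i : ℝ) / v) = bucketVal ω l b x := by
    intro b
    rw [bucketVal, Finset.mul_sum]
    push_cast
    exact Finset.sum_congr rfl fun i _ => by field_simp
  have e2 : ∀ i, v * ((x i : ℝ) / v) = x i := fun i => by field_simp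
  simp only [e1, e2]
  rw [← Finset.sum_div, ← Finset.sum_div, ← mul_div_assoc, ← sub_div, abs_div,
    abs_of_pos (by positivity : 0 < 4 * v ^ p), div_le_iff₀ (by positivity), mul_comm (4 * v ^ p)]

end Entries

/-! ### Top moments and their dual description -/

section Rearrangement

variable {n : ℕ}

/-- The absolute value of the `i`-th largest coordinate. -/
noncomputable def mag (x : Fin n → ℤ) (i : ℕ) : ℝ := ((|rearr x i| : ℤ) : ℝ)

lemma mag_nonneg (x : Fin n → ℤ) (i : ℕ) : 0 ≤ mag x i := by
  unfold mag; exact_mod_cast abs_nonneg _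

lemma topMoment_eq (p : ℝ) (x : Fin n → ℤ) (k : ℕ) :
    topMoment p x k = ∑ i ∈ Finset.Icc 1 k, mag x i ^ p := rfl

lemma mag_sq (x : Fin n → ℤ) (i : ℕ) : mag x i ^ 2 = (rearr x i : ℝ) ^ 2 := by
  unfold mag; push_cast; exact sq_abs _

lemma rearr_succ (x : Fin n → ℤ) (i : Fin n) :
    rearr x (i + 1) = x (Tuple.sort (fun l => -|x l|) i) := by
  have h : 1 ≤ (i : ℕ) + 1 ∧ (i : ℕ) + 1 ≤ n := by omega
  rw [rearr, dif_pos h]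
  congr 2

lemma sum_rearr (x : Fin n → ℤ) (g : ℤ → ℝ) :
    ∑ i ∈ Finset.Icc 1 n, g (rearr x i) = ∑ l, g (x l) := by
  rw [← Equiv.sum_comp (Tuple.sort fun l => -|x l|)]
  simp only [← rearr_succ]
  rw [Fin.sum_univ_eq_sum_range (fun i => g (rearr x (i + 1))) n, Finset.range_eq_Ico,
    Finset.sum_Ico_add' (fun i => g (rearr x i)) 0 n 1]
  rfl

lemma mag_anti (x : Fin n → ℤ) {i j : ℕ} (hi : 1 ≤ i) (hij : i ≤ j) : mag x j ≤ mag x i := by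
  by_cases hj : j ≤ n
  · obtain ⟨i, rfl⟩ := Nat.exists_eq_add_of_le' hi
    obtain ⟨j, rfl⟩ := Nat.exists_eq_add_of_le' (hi.trans hij)
    have h := Tuple.monotone_sort (fun l => -|x l|) (show (⟨i, by omega⟩ : Fin n) ≤ ⟨j, by omega⟩ by
      simp only [Fin.mk_le_mk]; omega)
    have e1 := rearr_succ x ⟨i, by omega⟩
    have e2 := rearr_succ x ⟨j, by omega⟩
    simp only [Function.comp] at h e1 e2
    simp only [mag, e1, e2]
    exact_mod_cast neg_le_neg_iff.1 h
  · have : mag x j = 0 := by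
      unfold mag rearr
      rw [dif_neg (by omega)]; simp
    rw [this]
    exact mag_nonneg x i

lemma abs_le_mag_one (x : Fin n → ℤ) (l : Fin n) : |(x l : ℝ)| ≤ mag x 1 := by
  set i := (Tuple.sort fun l => -|x l|).symm l with hi
  have h := rearr_succ x i
  rw [hi, Equiv.apply_symm_apply, ← hi] at h
  have : |(x l : ℝ)| = mag x (i + 1) := by rw [mag, h]; push_cast; rfl
  rw [this]
  exact mag_anti x le_rfl (by omega)

lemma mag_le {x : Fin n → ℤ} {b : ℝ} (hb : 0 ≤ b) (h : ∀ l, |(x l : ℝ)| ≤ b) (i : ℕ) :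
    mag x i ≤ b := by
  unfold mag rearr
  split_ifs with hi
  · push_cast; exact h _
  · simpa using hb

variable {p : ℝ}

lemma topMoment_mono (x : Fin n → ℤ) {k l : ℕ} (h : k ≤ l) : topMoment p x k ≤ topMoment p x l :=
  Finset.sum_le_sum_of_subset_of_nonneg (Finset.Icc_subset_Icc le_rfl h)
    fun i _ _ => Real.rpow_nonneg (mag_nonneg x i) _

lemma topMoment_nonneg (x : Fin n → ℤ) (k : ℕ) : 0 ≤ topMoment p x k :=
  Finset.sum_nonneg fun i _ => Real.rpow_nonneg (mag_nonneg x i) _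

lemma mul_mag_rpow_le (hp : 0 ≤ p) (x : Fin n → ℤ) (k : ℕ) :
    k * mag x k ^ p ≤ topMoment p x k := by
  rw [topMoment_eq]
  have := Finset.card_nsmul_le_sum (Finset.Icc 1 k) (fun i => mag x i ^ p) (mag x k ^ p)
    fun i hi => Real.rpow_le_rpow (mag_nonneg _ _)
      (mag_anti x (Finset.mem_Icc.1 hi).1 (Finset.mem_Icc.1 hi).2) hp
  simpa using this

lemma topMoment_eq_add (x : Fin n → ℤ) {k l : ℕ} (h : k ≤ l) :
    topMoment p x l = topMoment p x k + ∑ i ∈ Finset.Icc (k + 1) l, mag x i ^ p := by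
  rw [topMoment_eq, topMoment_eq, ← Finset.sum_union]
  · congr 1; ext i; simp only [Finset.mem_union, Finset.mem_Icc]; omega
  · rw [Finset.disjoint_left]; intro i; simp only [Finset.mem_Icc]; omega

/-- The averages of the top moments are non-increasing. -/
lemma mul_topMoment_le (hp : 0 ≤ p) (x : Fin n → ℤ) {k l : ℕ} (h : k ≤ l) :
    k * topMoment p x l ≤ l * topMoment p x k := by
  rcases Nat.eq_zero_or_pos k with rfl | hk
  · simp [topMoment]
  have h1 := mul_mag_rpow_le hp x k
  have h2 : ∑ i ∈ Finset.Icc (k + 1) l, mag x i ^ p ≤ (l - k) * mag x k ^ p := by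
    have := Finset.sum_le_card_nsmul (Finset.Icc (k + 1) l) (fun i => mag x i ^ p) (mag x k ^ p)
      fun i hi => Real.rpow_le_rpow (mag_nonneg _ _)
        (mag_anti x hk (by have := (Finset.mem_Icc.1 hi).1; omega)) hp
    rw [Nat.card_Icc, nsmul_eq_mul, show l + 1 - (k + 1) = l - k by omega, Nat.cast_sub h] at this
    exact this
  have hkl : (k : ℝ) ≤ l := by exact_mod_cast h
  rw [topMoment_eq_add x h]
  have hk0 : (0 : ℝ) ≤ k := Nat.cast_nonneg _
  nlinarith [mul_le_mul_of_nonneg_left h2 hk0, mul_le_mul_of_nonneg_left h1 (sub_nonneg.2 hkl)]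

lemma sum_excess_eq (x : Fin n → ℤ) (t : ℝ) :
    ∑ l, excess p t |(x l : ℝ)| = ∑ i ∈ Finset.Icc 1 n, excess p t (mag x i) := by
  rw [← sum_rearr x fun z => excess p t |(z : ℝ)|]
  simp [mag]

/-- One half of the duality, valid for every threshold: each `a_i ^ p` is at most `t` plus its
excess. -/
lemma topMoment_le_excess (x : Fin n → ℤ) {m : ℕ} (hm : m ≤ n) (t : ℝ) :
    topMoment p x m ≤ m * t + ∑ l, excess p t |(x l : ℝ)| := by
  rw [sum_excess_eq, topMoment_eq]
  calc ∑ i ∈ Finset.Icc 1 m, mag x i ^ p ≤ ∑ i ∈ Finset.Icc 1 m, (t + excess p t (mag x i)) := by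
        refine Finset.sum_le_sum fun i _ => ?_
        have : mag x i ^ p - t ≤ excess p t (mag x i) := le_max_left _ _
        linarith
    _ = m * t + ∑ i ∈ Finset.Icc 1 m, excess p t (mag x i) := by
        rw [Finset.sum_add_distrib]; simp
    _ ≤ _ := by
        gcongr
        exact fun i _ _ => excess_nonneg _

/-- The other half: once `t` is at least the `m`-th largest power, only the top `m` entries have an
excess. Together the two halves are tight up to `m * (t - mag x m ^ p)`. -/
lemma excess_le_topMoment (hp : 0 ≤ p) (x : Fin n → ℤ) {m : ℕ} (h1 : 1 ≤ m) (hm : m ≤ n) {t : ℝ}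
    (ht : mag x m ^ p ≤ t) :
    m * mag x m ^ p + ∑ l, excess p t |(x l : ℝ)| ≤ topMoment p x m := by
  rw [sum_excess_eq, topMoment_eq]
  have e : ∑ i ∈ Finset.Icc 1 n, excess p t (mag x i) =
      ∑ i ∈ Finset.Icc 1 m, excess p t (mag x i) := by
    symm
    refine Finset.sum_subset (Finset.Icc_subset_Icc le_rfl hm) fun i hi hi' => ?_
    refine excess_eq_zero (le_trans ?_ ht)
    simp only [Finset.mem_Icc] at hi hi'
    exact Real.rpow_le_rpow (mag_nonneg _ _) (mag_anti x h1 (by omega)) hp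
  rw [e]
  have : (m : ℝ) * mag x m ^ p = ∑ i ∈ Finset.Icc 1 m, mag x m ^ p := by simp
  rw [this, ← Finset.sum_add_distrib]
  refine Finset.sum_le_sum fun i hi => ?_
  have h := Real.rpow_le_rpow (mag_nonneg x m) (mag_anti x (Finset.mem_Icc.1 hi).1
    (Finset.mem_Icc.1 hi).2) hp
  have : excess p t (mag x i) ≤ mag x i ^ p - mag x m ^ p :=
    max_le (by linarith) (by linarith)
  linarith

/-- The squared norm of the input truncated at `v`. -/
lemma sum_min_sq_le (hp1 : 1 ≤ p) (hp2 : p ≤ 2) (x : Fin n → ℤ) {j : ℕ} (hj : j ≤ n) {v : ℝ}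
    (hv : 0 < v) :
    ∑ l, min ((x l : ℝ) ^ 2) (v ^ 2) ≤ v ^ (2 - p) * topMoment p x j + (tailSq x j : ℝ) := by
  rw [← sum_rearr x fun z => min ((z : ℝ) ^ 2) (v ^ 2)]
  have hsplit : Finset.Icc 1 n = Finset.Icc 1 j ∪ Finset.Icc (j + 1) n := by
    ext i; simp only [Finset.mem_union, Finset.mem_Icc]; omega
  rw [hsplit, Finset.sum_union (by
    rw [Finset.disjoint_left]; intro i; simp only [Finset.mem_Icc]; omega), topMoment_eq,
    Finset.mul_sum]
  gcongr ?_ + ?_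
  · refine Finset.sum_le_sum fun i _ => ?_
    rw [← mag_sq]
    have h0 := mag_nonneg x i
    set a := mag x i
    -- The top part is bounded by interpolation: `min a v ^ 2` is at most `v ^ (2 - p) * a ^ p`.
    have hsq : ∀ b : ℝ, 0 < b → b ^ 2 = b ^ (2 - p) * b ^ p := fun b hb => by
      rw [← Real.rpow_add hb, sub_add_cancel, Real.rpow_two]
    rcases h0.eq_or_lt with h | h
    · rw [← h]
      refine (min_le_left _ _).trans ?_
      rw [zero_pow two_ne_zero]
      exact mul_nonneg (Real.rpow_nonneg hv.le _) (Real.rpow_nonneg le_rfl _)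
    · rcases le_total a v with hav | hav
      · refine (min_le_left _ _).trans ?_
        rw [hsq a h]
        have := Real.rpow_le_rpow h0 hav (by linarith : 0 ≤ 2 - p)
        have := Real.rpow_nonneg h0 p
        gcongr
      · refine (min_le_right _ _).trans ?_
        rw [hsq v hv]
        have := Real.rpow_nonneg hv.le (2 - p)
        gcongr
  · unfold tailSq
    push_cast
    exact Finset.sum_le_sum fun i _ => min_le_left _ _

lemma topMoment_lt_of_isGIndex {x : Fin n → ℤ} {k : ℕ} (hk : IsGIndex p x k) (h : k + 1 ≤ n) :
    topMoment p x (k + 1) < ((k + 1 : ℕ) : ℝ) ^ (p + 1) := by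
  by_contra hc
  have := hk.2 (show k + 1 ∈ {j : ℕ | j ≤ n ∧ (j : ℝ) ^ (p + 1) ≤ topMoment p x j} from
    ⟨h, not_lt.1 hc⟩)
  omega

end Rearrangement

/-! ### Lightness, levels and the separating threshold -/

section Pair

/-- At sampling rate `2 ^ (-l)` the input has few entries above `v` and little mass below `v`. -/
def IsLight {n : ℕ} (Λ : ℝ) (l : ℕ) (v : ℝ) (x : Fin n → ℤ) : Prop :=
  (1 / 2) ^ l * ∑ i, min ((x i : ℝ) ^ 2) (v ^ 2) ≤ Λ * v ^ 2

/-- As `p ≥ 1`, the ratio `a / b` is at most `max 1 ((a / b) ^ p)`, hence at most `J / j`; it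
remains to square. -/
lemma mul_sq_le_of_mul_rpow_le {p j a J b : ℝ} (hp : 1 ≤ p) (hj : 0 < j) (hjJ : j ≤ J)
    (ha : 0 ≤ a) (hb : 0 < b) (h : j * a ^ p ≤ J * b ^ p) : j * a ^ 2 ≤ J ^ 2 / j * b ^ 2 := by
  have key : a ≤ J / j * b := by
    rcases le_total a b with hab | hab
    · have : 1 ≤ J / j := (one_le_div hj).2 hjJ
      nlinarith
    · have h1 : a / b ≤ (a / b) ^ p := by
        simpa using Real.rpow_le_rpow_of_exponent_le ((one_le_div hb).2 hab) hp
      have h2 : (a / b) ^ p ≤ J / j := by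
        rw [Real.div_rpow ha hb.le, div_le_div_iff₀ (Real.rpow_pos_of_pos hb p) hj]
        linarith
      have := h1.trans h2
      rwa [div_le_iff₀ hb] at this
  calc j * a ^ 2 ≤ j * (J / j * b) ^ 2 := by gcongr
    _ = _ := by field_simp

/-- For `p ≥ 1` one has `2 - p ≤ p`, so a ratio above 1 only shrinks when its exponent drops from
`p` to `2 - p`. -/
lemma rpow_two_sub_le {p μ v D : ℝ} (hp1 : 1 ≤ p) (hp2 : p ≤ 2) (hμ : 0 < μ) (hv : 0 < v)
    (hD : 1 ≤ D) (h : μ ^ p ≤ D * v ^ p) : μ ^ (2 - p) ≤ D * v ^ (2 - p) := by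
  have hvp := Real.rpow_pos_of_pos hv (2 - p)
  rcases le_total μ v with hle | hle
  · have := Real.rpow_le_rpow hμ.le hle (by linarith : 0 ≤ 2 - p)
    nlinarith
  · rw [← div_le_iff₀ hvp, ← Real.div_rpow hμ.le hv.le]
    calc (μ / v) ^ (2 - p) ≤ (μ / v) ^ p :=
          Real.rpow_le_rpow_of_exponent_le ((one_le_div hv).2 hle) (by linarith)
      _ ≤ D := by
        rw [Real.div_rpow hμ.le hv.le, div_le_iff₀ (Real.rpow_pos_of_pos hv p)]
        exact h

/-- The truncated square mass is at most `v ^ (2 - p)` times the top moment plus the tail. Writing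
`μ ^ 2 = μ ^ (2 - p) * μ ^ p`, both parts contain `m * μ ^ p`, which the rate reduces to `2 * Γ * v
^ p`; what remains is comparable with `v ^ (2 - p)`. -/
lemma isLight_of_tail {n : ℕ} {p μ v m L Γ D : ℝ} (hp1 : 1 ≤ p) (hp2 : p ≤ 2) (hμ : 0 < μ)
    (hv : 0 < v) (hL : 1 ≤ L) (hΓ : 1 ≤ Γ) (hD : 1 ≤ D)
    (hμv : μ ^ p ≤ D * v ^ p) {l : ℕ} (hl : (1 / 2 : ℝ) ^ l * (m * μ ^ p) ≤ 2 * Γ * v ^ p)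
    (x : Fin n → ℤ) {j : ℕ} (hj : j ≤ n) (hM : topMoment p x j ≤ m * μ ^ p)
    (htail : (tailSq x j : ℝ) ≤ L * (8 * (m * μ ^ 2))) :
    IsLight (18 * Γ * L * D) l v x := by
  have hvp := Real.rpow_pos_of_pos hv p
  have hμp := Real.rpow_pos_of_pos hμ p
  have hv2p := Real.rpow_pos_of_pos hv (2 - p)
  have hsqv : v ^ (2 - p) * v ^ p = v ^ 2 := by
    rw [← Real.rpow_add hv, sub_add_cancel, Real.rpow_two]
  have hsqμ : μ ^ (2 - p) * μ ^ p = μ ^ 2 := by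
    rw [← Real.rpow_add hμ, sub_add_cancel, Real.rpow_two]
  have h1 := sum_min_sq_le hp1 hp2 x hj hv
  have h2 := rpow_two_sub_le hp1 hp2 hμ hv hD hμv
  set q := (1 / 2 : ℝ) ^ l
  have hq : 0 < q := by positivity
  unfold IsLight
  have hLD : 1 ≤ L * D := one_le_mul_of_one_le_of_one_le hL hD
  calc q * ∑ i, min ((x i : ℝ) ^ 2) (v ^ 2)
      ≤ q * (v ^ (2 - p) * (m * μ ^ p) + L * (8 * (m * (μ ^ (2 - p) * μ ^ p)))) := by
        rw [hsqμ]; gcongr; exact h1.trans (by gcongr)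
    _ = (q * (m * μ ^ p)) * (v ^ (2 - p) + 8 * L * μ ^ (2 - p)) := by ring
    _ ≤ (2 * Γ * v ^ p) * (v ^ (2 - p) + 8 * L * (D * v ^ (2 - p))) := by gcongr
    _ = 2 * Γ * (1 + 8 * (L * D)) * (v ^ (2 - p) * v ^ p) := by ring
    _ = 2 * Γ * (1 + 8 * (L * D)) * v ^ 2 := by rw [hsqv]
    _ ≤ 2 * Γ * (9 * (L * D)) * v ^ 2 := by gcongr; linarith
    _ = _ := by ring

/-- The level on which a scale is inspected. -/
lemma exists_level {M w : ℝ} (hw : 0 < w) {N : ℕ} (hN : M ≤ w * 2 ^ N) :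
    ∃ l ≤ N, (1 / 2 : ℝ) ^ l * M ≤ 2 * w ∧ (l = 0 ∨ 2 ^ l * w ≤ M) := by
  -- Either level 0 suffices, or `l` is determined by `2 ^ l * w ≤ M < 2 ^ (l + 1) * w`.
  by_cases h : M ≤ w
  · exact ⟨0, Nat.zero_le _, by simp; linarith, Or.inl rfl⟩
  · obtain ⟨l, hl1, hl2⟩ := exists_nat_pow_near (x := M / w) (y := (2 : ℝ))
      ((one_le_div hw).2 (not_le.1 h).le) (by norm_num)
    rw [le_div_iff₀ hw] at hl1
    rw [div_lt_iff₀ hw] at hl2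
    refine ⟨l, ?_, ?_, Or.inr hl1⟩
    · have : (2 : ℝ) ^ l ≤ 2 ^ N := le_of_mul_le_mul_right (by linarith) hw
      exact (pow_le_pow_iff_right₀ (by norm_num)).1 this
    · have e : (2 : ℝ) ^ l * (1 / 2) ^ l = 1 := by rw [← mul_pow]; norm_num
      calc (1 / 2 : ℝ) ^ l * M ≤ (1 / 2 : ℝ) ^ l * (2 ^ (l + 1) * w) := by gcongr
        _ = 2 * (2 ^ l * (1 / 2) ^ l) * w := by ring
        _ = 2 * w := by rw [e, mul_one]

/-- The index condition bounds the moments of a vector beyond its index. -/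
lemma topMoment_le_of_isGIndex {n : ℕ} {p : ℝ} (hp : 1 ≤ p) {x : Fin n → ℤ} {k : ℕ}
    (hk : IsGIndex p x k) {m : ℕ} (hkm : k + 1 ≤ m) (hm : m ≤ n) :
    topMoment p x m ≤ m * ((k : ℝ) + 1) ^ p := by
  have h1 := topMoment_lt_of_isGIndex hk (hkm.trans hm)
  have h2 := mul_topMoment_le (by linarith : 0 ≤ p) x hkm
  push_cast at h1 h2
  have hK : (0 : ℝ) < (k : ℝ) + 1 := by positivity
  rw [Real.rpow_add hK, Real.rpow_one] at h1
  have hm0 : (0 : ℝ) ≤ m := Nat.cast_nonneg _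
  have : ((k : ℝ) + 1) * topMoment p x m ≤ ((k : ℝ) + 1) * (m * ((k : ℝ) + 1) ^ p) := by
    nlinarith
  exact le_of_mul_le_mul_left this hK

lemma le_topMoment_of_isGIndex {n : ℕ} {p : ℝ} (hp : 1 ≤ p) {x : Fin n → ℤ} {k : ℕ}
    (hk : IsGIndex p x k) {m : ℕ} (hm : m ≤ k) : m * (k : ℝ) ^ p ≤ topMoment p x m := by
  rcases Nat.eq_zero_or_pos k with rfl | hk0
  · obtain rfl : m = 0 := by omega
    simp [topMoment]
  have h1 := hk.1.2
  have h2 := mul_topMoment_le (by linarith : 0 ≤ p) x hm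
  have hK : (0 : ℝ) < k := by exact_mod_cast hk0
  rw [Real.rpow_add hK, Real.rpow_one] at h1
  have hm0 : (0 : ℝ) ≤ m := Nat.cast_nonneg _
  have : (k : ℝ) * (m * (k : ℝ) ^ p) ≤ k * topMoment p x m := by nlinarith
  exact le_of_mul_le_mul_left this hK

/-- A threshold that separates two vectors with different top moments. -/
lemma exists_threshold {n : ℕ} {p : ℝ} (hp1 : 1 ≤ p) (x y : Fin n → ℤ) {m : ℕ}
    (hm1 : 1 ≤ m) (hm : m ≤ n) {ε : ℝ} {Q : ℕ} (hQ : 1 ≤ Q) (hε1 : ε ≤ 1) (hQε : 1 / (Q : ℝ) ≤ ε)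
    (hgap : (1 + ε) * topMoment p x m ≤ topMoment p y m) {E : ℕ}
    (hlow : (m : ℝ) ≤ topMoment p y m) (hup : topMoment p y m ≤ m * 2 ^ E) :
    ∃ a ≤ E, ∃ r ≤ 32 * Q + 1, 1 ≤ r ∧
      topMoment p y m ≤ m * (32 * Q * (2 ^ a * r / (16 * Q) : ℝ)) ∧
      topMoment p y m / (4 * Q) ≤ ∑ l, excess p (2 ^ a * r / (16 * Q)) |(y l : ℝ)| -
        ∑ l, excess p (2 ^ a * r / (16 * Q)) |(x l : ℝ)| := by
  set M := topMoment p y m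
  have hQ0 : (1 : ℝ) ≤ Q := by exact_mod_cast hQ
  have hm0 : (1 : ℝ) ≤ m := by exact_mod_cast hm1
  have hM0 : 0 < M := by linarith
  have hε0 : 0 < ε := lt_of_lt_of_le (by positivity) hQε
  -- The mean `M / m` fixes the binary order of magnitude `2 ^ a`; the grid has mesh `2 ^ a / (16 *
  -- Q)`.
  obtain ⟨a, ha1, ha2⟩ := exists_nat_pow_near (x := M / m) (y := (2 : ℝ))
    ((one_le_div (by linarith)).2 hlow) (by norm_num)
  rw [le_div_iff₀ (by linarith)] at ha1
  rw [div_lt_iff₀ (by linarith)] at ha2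
  have haE : a ≤ E := by
    have : (2 : ℝ) ^ a ≤ 2 ^ E := le_of_mul_le_mul_right (by linarith) (by linarith : (0 : ℝ) < m)
    exact (pow_le_pow_iff_right₀ (by norm_num)).1 this
  set τ := mag x m ^ p
  have hτ0 : 0 ≤ τ := Real.rpow_nonneg (mag_nonneg _ _) _
  have hτM : m * τ ≤ topMoment p x m := mul_mag_rpow_le (by linarith) x m
  have hxM : topMoment p x m ≤ M := by
    have := topMoment_nonneg (p := p) x m
    nlinarith
  have h2a : (0 : ℝ) < 2 ^ a := by positivity
  have hτa : τ < 2 ^ (a + 1) := by nlinarith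
  -- `g` is `τ` measured in mesh units. Taking `⌊g⌋₊ + 1` rounds `τ` up and keeps the threshold
  -- positive even if `τ = 0`.
  set g : ℝ := τ * (16 * Q) / 2 ^ a
  have hg0 : 0 ≤ g := by positivity
  have hgr : g < 32 * Q := by
    rw [div_lt_iff₀ h2a]
    rw [pow_succ] at hτa
    nlinarith
  have hfl := Nat.floor_le hg0
  have hfl2 := Nat.lt_floor_add_one g
  refine ⟨a, haE, ⌊g⌋₊ + 1, ?_, by omega, ?_, ?_⟩
  · have : (⌊g⌋₊ : ℝ) < (32 * Q : ℕ) := by push_cast; linarith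
    have : ⌊g⌋₊ < 32 * Q := by exact_mod_cast this
    omega
  · have e : (32 * Q * (2 ^ a * ((⌊g⌋₊ + 1 : ℕ) : ℝ) / (16 * Q)) : ℝ) =
        2 * 2 ^ a * ((⌊g⌋₊ : ℝ) + 1) := by push_cast; field_simp; norm_num
    rw [e]
    have hf0 : (0 : ℝ) ≤ (⌊g⌋₊ : ℝ) := Nat.cast_nonneg _
    have : 2 ^ (a + 1) * (m : ℝ) ≤ m * (2 * 2 ^ a * ((⌊g⌋₊ : ℝ) + 1)) := by
      rw [pow_succ]
      nlinarith [mul_nonneg (mul_nonneg h2a.le hf0) (by linarith : (0 : ℝ) ≤ m)]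
    linarith
  · set t : ℝ := 2 ^ a * ((⌊g⌋₊ + 1 : ℕ) : ℝ) / (16 * Q) with ht
    have hτt : τ ≤ t := by
      rw [ht, le_div_iff₀ (by positivity)]
      push_cast
      have : g * 2 ^ a = τ * (16 * Q) := by simp only [g]; field_simp
      nlinarith
    have htτ : t ≤ τ + 2 ^ a / (16 * Q) := by
      have : (⌊g⌋₊ : ℝ) * 2 ^ a ≤ τ * (16 * Q) := by
        have : g * 2 ^ a = τ * (16 * Q) := by simp only [g]; field_simp
        nlinarith
      rw [ht, div_le_iff₀ (by positivity), add_mul, div_mul_cancel₀ _ (by positivity)]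
      push_cast
      linarith
    -- The excess of `y` is at least `M - m t`, that of `x` at most its top moment minus `m τ`. The
    -- moments differ by at least `M / (2 * Q)`, and rounding costs at most `M / (16 * Q)`.
    have i1 := topMoment_le_excess (p := p) y hm t
    have i2 := excess_le_topMoment (by linarith : 0 ≤ p) x hm1 hm hτt
    have i3 : m * t ≤ m * τ + M / (16 * Q) := by
      have : m * (2 ^ a / (16 * Q)) ≤ M / (16 * Q) := by
        rw [← mul_div_assoc]; gcongr; linarith
      nlinarith
    have i4 : M / (2 * Q) ≤ M - topMoment p x m := by
      have h1 : M / Q ≤ M * ε := by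
        rw [div_eq_mul_one_div]; gcongr
      have h2 : M / (2 * Q) = (M / Q) / 2 := by field_simp
      rw [h2]
      have : (1 + ε) * (M - topMoment p x m) ≥ ε * M := by linarith
      nlinarith [sub_nonneg.2 hxM]
    have e1 : M / (2 * Q) = 8 * (M / (16 * Q)) := by field_simp; norm_num
    have e2 : M / (4 * Q) = 4 * (M / (16 * Q)) := by field_simp; norm_num
    have i5 : 0 ≤ M / (16 * Q) := by positivity
    linarith

end Pair

/-! ### Equal sketches force compatible indices -/

section Separation

/-- The residual mass of an input that satisfies the promise, compared with the top moment of a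
second input whose index is much larger. -/
lemma index_energy_le {n : ℕ} {p ε : ℝ} (hp1 : 1 ≤ p) (hε1 : ε < 1) {x : Fin n → ℤ} {k j : ℕ}
    (hε0 : 0 < ε) (hk : IsGIndex p x k) (hkn : k + 1 ≤ n) (hj : |(j : ℝ) - (1 - ε) * k| < 1)
    {m k' : ℝ} (hm2 : 2 ≤ m) (hKm : (k : ℝ) + 1 ≤ m) (hmk' : m ≤ k') (hm1 : m - 1 ≤ (1 - ε) * k') :
    (j : ℝ) * mag x j ^ 2 ≤ 8 * (m * k' ^ 2) := by
  set K : ℝ := (k : ℝ) + 1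
  have hk0 : (0 : ℝ) ≤ k := Nat.cast_nonneg _
  rw [abs_lt] at hj
  have hjk : j ≤ k := by
    have : (j : ℝ) < (k + 1 : ℕ) := by push_cast; nlinarith [hj.2]
    have : j < k + 1 := by exact_mod_cast this
    omega
  rcases Nat.eq_zero_or_pos j with h0 | h0
  · rw [h0]; simp; positivity
  have hj1 : (1 : ℝ) ≤ j := by exact_mod_cast h0
  have hk1 : (1 : ℝ) ≤ k := hj1.trans (by exact_mod_cast hjk)
  have hjK : (j : ℝ) ≤ K := by
    have : (j : ℝ) ≤ k := by exact_mod_cast hjk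
    simp only [K]; linarith
  have h1 : (j : ℝ) * mag x j ^ p ≤ K * K ^ p := by
    have a1 := mul_mag_rpow_le (by linarith : 0 ≤ p) x j
    have a2 := topMoment_mono (p := p) x (show j ≤ k + 1 by omega)
    have a3 := topMoment_lt_of_isGIndex hk hkn
    push_cast at a3
    rw [Real.rpow_add (by positivity), Real.rpow_one] at a3
    linarith
  have h2 := mul_sq_le_of_mul_rpow_le hp1 (by linarith) hjK (mag_nonneg x j) (by positivity) h1
  refine h2.trans ?_
  -- When `ε` is near 1, `j` may be far below `k`, so `h2` loses `K / j`, of order `1 / (1 - ε)`.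
  -- This is regained from `m ≤ 2 * (1 - ε) * k'`, which makes the bound uniform in `ε`.
  have h3 : (1 - ε) * K ≤ 4 * j := by
    have : (1 - ε) * k ≤ j + 1 := by linarith [hj.1]
    have : (1 - ε) * K ≤ 2 * ((1 - ε) * k) := by
      simp only [K]; nlinarith
    linarith
  have h4 : m ≤ 2 * ((1 - ε) * k') := by linarith
  have hε : 0 < 1 - ε := by linarith
  have hKk' : K ≤ k' := hKm.trans hmk'
  have hK0 : 0 < K := by positivity
  rw [div_mul_eq_mul_div, div_le_iff₀ (by linarith)]
  have h5 : K ^ 3 ≤ m ^ 2 * k' := by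
    calc K ^ 3 = K ^ 2 * K := by ring
      _ ≤ m ^ 2 * k' := by gcongr
  have h6 : m ^ 2 * k' ≤ 2 * (1 - ε) * (m * k' ^ 2) := by
    have : 0 ≤ m * k' := by nlinarith
    nlinarith
  have h7 : (1 - ε) * (K ^ 2 * K ^ 2) ≤ 4 * j * K ^ 3 := by
    have : 0 ≤ K ^ 3 := by positivity
    nlinarith
  have h8 : 4 * j * K ^ 3 ≤ (1 - ε) * (8 * (m * k' ^ 2) * j) := by
    have : K ^ 3 ≤ 2 * (1 - ε) * (m * k' ^ 2) := h5.trans h6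
    nlinarith
  exact le_of_mul_le_mul_left (h7.trans h8) hε

/-- Here `j` and `m` agree up to a factor 2, so passing from `p`-th powers to squares costs only a
constant. -/
lemma own_energy_le {n : ℕ} {p : ℝ} (hp1 : 1 ≤ p) {y : Fin n → ℤ} {m j : ℕ} (hj : 1 ≤ j)
    (hjm : j ≤ m) (hmj : m ≤ 2 * j) {μ : ℝ} (hμ : 0 < μ)
    (hM : topMoment p y m = m * μ ^ p) : (j : ℝ) * mag y j ^ 2 ≤ 8 * (m * μ ^ 2) := by
  have hj1 : (1 : ℝ) ≤ j := by exact_mod_cast hj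
  have h1 : (j : ℝ) * mag y j ^ p ≤ m * μ ^ p := by
    rw [← hM]
    exact (mul_mag_rpow_le (by linarith) y j).trans (topMoment_mono y hjm)
  have h2 := mul_sq_le_of_mul_rpow_le hp1 (by linarith) (by exact_mod_cast hjm) (mag_nonneg y j)
    hμ h1
  refine h2.trans ?_
  have h3 : (m : ℝ) ≤ 2 * j := by exact_mod_cast hmj
  have hm0 : (0 : ℝ) ≤ m := Nat.cast_nonneg _
  have h4 : (m : ℝ) ^ 2 / j ≤ 2 * m := by
    rw [div_le_iff₀ (by linarith)]; nlinarith
  have : 0 ≤ μ ^ 2 := by positivity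
  nlinarith [mul_nonneg hm0 this]

/-- The pieces at one scale of two inputs with small residual mass differ by little. -/
lemma piece_gap_le {n Q S m j j' : ℕ} {p μ t v L η₁ : ℝ} (hp1 : 1 ≤ p) (hp2 : p ≤ 2)
    (hQ1 : (1 : ℝ) ≤ Q) (hS4 : (4 : ℝ) ≤ S) (hL : 1 ≤ L) (hη₁ : 0 ≤ η₁) (hμ0 : 0 < μ) (hm1 : 1 ≤ m)
    (hmQ : (m : ℝ) ≤ 2 ^ Q) (hv0 : 0 < v) (hμt : μ ^ p ≤ 32 * Q * t) {x y : Fin n → ℤ}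
    (hMμ : topMoment p y m = m * μ ^ p) (hj : j ≤ n) (hj' : j' ≤ n) (hj'm : j' ≤ m)
    (hxj : topMoment p x j ≤ m * μ ^ p) (hLx : (tailSq x j : ℝ) ≤ L * (8 * (m * μ ^ 2)))
    (hLy : (tailSq y j' : ℝ) ≤ L * (8 * (m * μ ^ 2)))
    (hclose : ∀ l ≤ Q, IsLight (18 * (64 * Q * S * (η₁ + 1)) * L * (128 * Q)) l v x →
      IsLight (18 * (64 * Q * S * (η₁ + 1)) * L * (128 * Q)) l v y →
      ∑ i, piece p t v (y i) - ∑ i, piece p t v (x i) ≤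
        2 ^ l * (8 * v ^ p * (1 / (64 * Q * S) + (1 - (1 / 2) ^ l) * η₁))) :
    ∑ i, piece p t v (y i) - ∑ i, piece p t v (x i) ≤ m * μ ^ p / (8 * Q * S) := by
  have hp0 : 0 ≤ p := by linarith
  have hvp := Real.rpow_pos_of_pos hv0 p
  have hμp := Real.rpow_pos_of_pos hμ0 p
  have hm0 : (1 : ℝ) ≤ m := by exact_mod_cast hm1
  have hrhs : 0 ≤ m * μ ^ p / (8 * Q * S) := by positivity
  have hx0 : 0 ≤ ∑ i, piece p t v (x i) := Finset.sum_nonneg fun i _ => piece_nonneg hp0 hv0 _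
  -- Below the threshold the piece vanishes identically.
  rcases le_or_gt ((2 * v) ^ p) t with h2v | h2v
  · rw [Finset.sum_eq_zero fun i _ => piece_eq_zero_of_le hp0 hv0 h2v (y i)]
    linarith
  -- If `v ^ p` is at least the top moment of `y`, no entry of `y` exceeds `v`, and the pieces of
  -- `x` are nonnegative.
  rcases le_or_gt (m * μ ^ p) (v ^ p) with hMv | hMv
  · rw [Finset.sum_eq_zero fun i _ => piece_eq_zero hv0 ?_]
    · linarith
    · refine (abs_le_mag_one y i).trans ?_
      have h1 : mag y 1 ^ p ≤ m * μ ^ p := by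
        rw [← hMμ]
        simpa using (mul_mag_rpow_le hp0 y 1).trans (topMoment_mono y hm1)
      exact (Real.rpow_le_rpow_iff (mag_nonneg _ _) hv0.le (by linarith)).1 (h1.trans hMv)
  -- With this `Γ`, the total error `2 ^ l * (8 * v ^ p * (η₁ + 1))` equals `2 ^ l * (Γ * v ^ p) /
  -- (8 * Q * S)`.
  set Γ : ℝ := 64 * Q * S * (η₁ + 1) with hΓ
  have hQS : 1 ≤ 64 * (Q : ℝ) * S := by nlinarith
  have hΓQ : 128 * (Q : ℝ) ≤ Γ := by
    calc 128 * (Q : ℝ) ≤ 64 * Q * S * 1 := by nlinarith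
      _ ≤ Γ := by rw [hΓ]; gcongr; linarith
  have hΓ1 : 1 ≤ Γ := by linarith
  have hμv : μ ^ p ≤ 128 * Q * v ^ p := by
    have h2 := two_mul_rpow_le hp2 hv0
    calc μ ^ p ≤ 32 * Q * t := hμt
      _ ≤ 32 * Q * (4 * v ^ p) := by gcongr; linarith
      _ = _ := by ring
  obtain ⟨l, hl, hl1, hl2⟩ := exists_level (M := m * μ ^ p) (w := Γ * v ^ p) (by positivity)
    (N := Q) (by
      calc m * μ ^ p ≤ 2 ^ Q * (128 * Q * v ^ p) := by gcongr
        _ ≤ 2 ^ Q * (Γ * v ^ p) := by gcongr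
        _ = _ := by ring)
  rw [← mul_assoc 2 Γ] at hl1
  have hQ128 : 1 ≤ 128 * (Q : ℝ) := by linarith
  refine (hclose l hl
    (isLight_of_tail hp1 hp2 hμ0 hv0 hL hΓ1 hQ128 hμv hl1 x hj hxj hLx)
    (isLight_of_tail hp1 hp2 hμ0 hv0 hL hΓ1 hQ128 hμv hl1 y hj'
      (by rw [← hMμ]; exact topMoment_mono y hj'm) hLy)).trans ?_
  -- On level 0 the sampling error is absent and `v ^ p` is only known to be below `m * μ ^ p`, so
  -- the finer collision tolerance is essential there.
  rcases hl2 with rfl | hl2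
  · simp only [pow_zero, sub_self, zero_mul, add_zero, one_mul]
    calc 8 * v ^ p * (1 / (64 * Q * S)) ≤ 8 * (m * μ ^ p) * (1 / (64 * Q * S)) := by gcongr
      _ = _ := by field_simp; norm_num
  · have hq0 : (0 : ℝ) < (1 / 2) ^ l := by positivity
    have hη₀ : 1 / (64 * (Q : ℝ) * S) ≤ 1 := by rw [div_le_one (by positivity)]; exact hQS
    have h1 : 1 / (64 * (Q : ℝ) * S) + (1 - (1 / 2) ^ l) * η₁ ≤ η₁ + 1 := by
      have : (1 - (1 / 2 : ℝ) ^ l) * η₁ ≤ 1 * η₁ := by gcongr; linarith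
      linarith
    calc (2 : ℝ) ^ l * (8 * v ^ p * (1 / (64 * Q * S) + (1 - (1 / 2) ^ l) * η₁))
        ≤ 2 ^ l * (8 * v ^ p * (η₁ + 1)) := by gcongr
      _ = (2 ^ l * (Γ * v ^ p)) / (8 * Q * S) := by rw [hΓ]; field_simp; norm_num
      _ ≤ _ := by gcongr

/-- Two inputs that satisfy the promise and have close pieces on the levels on which they are light
have compatible indices. -/
theorem ceil_index_le {n d Q S : ℕ} {p ε L η₁ : ℝ} (hp1 : 1 ≤ p) (hp2 : p ≤ 2) (hε0 : 0 < ε)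
    (hε1 : ε < 1) (hQ : 1 ≤ Q) (hQε : 1 / (Q : ℝ) ≤ ε) (hn : n ≤ 2 ^ Q) (hS : S = d * Q + Q + 4)
    (hL : 1 ≤ L) (hη₁ : 0 ≤ η₁) {x y : Fin n → ℤ}
    (hy : ∀ i, |y i| ≤ (n : ℤ) ^ d) (hx : ∀ i, |x i| ≤ (n : ℤ) ^ d)
    {k k' j j' : ℕ} (hk : IsGIndex p x k) (hk' : IsGIndex p y k')
    (hj : |(j : ℝ) - (1 - ε) * k| < 1) (hj' : |(j' : ℝ) - (1 - ε) * k'| < 1)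
    (htail : (tailSq x j : ℝ) ≤ L * (j * mag x j ^ 2))
    (htail' : (tailSq y j' : ℝ) ≤ L * (j' * mag y j' ^ 2))
    (hclose : ∀ l ≤ Q, ∀ s < S, ∀ a ≤ 2 * d * Q, ∀ r ≤ 32 * Q + 1,
      IsLight (18 * (64 * Q * S * (η₁ + 1)) * L * (128 * Q)) l (1 / (16 * Q) * 2 ^ s) x →
      IsLight (18 * (64 * Q * S * (η₁ + 1)) * L * (128 * Q)) l (1 / (16 * Q) * 2 ^ s) y →
      ∑ i, piece p (2 ^ a * r / (16 * Q)) (1 / (16 * Q) * 2 ^ s) (y i) -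
        ∑ i, piece p (2 ^ a * r / (16 * Q)) (1 / (16 * Q) * 2 ^ s) (x i) ≤
      2 ^ l * (8 * (1 / (16 * Q) * 2 ^ s : ℝ) ^ p *
        (1 / (64 * Q * S) + (1 - (1 / 2) ^ l) * η₁))) :
    (⌈(1 - ε) * k'⌉₊ : ℝ) ≤ (1 + ε) * (k + 1) := by
  by_contra hcon
  push Not at hcon
  set m := ⌈(1 - ε) * k'⌉₊ with hmdef
  have hk0 : (0 : ℝ) ≤ k := Nat.cast_nonneg _
  have hk'0 : (0 : ℝ) ≤ k' := Nat.cast_nonneg _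
  have hp0 : 0 ≤ p := by linarith
  have hεk' : 0 ≤ (1 - ε) * k' := mul_nonneg (by linarith) hk'0
  have hKm : k + 1 < m := by
    have h0 : 0 ≤ ε * ((k : ℝ) + 1) := by positivity
    have : ((k + 1 : ℕ) : ℝ) < m := by push_cast; linarith
    exact_mod_cast this
  have hmk' : m ≤ k' := Nat.ceil_le.2 (by linarith [mul_nonneg hε0.le hk'0])
  have hm1 : (m : ℝ) < (1 - ε) * k' + 1 := Nat.ceil_lt_add_one hεk'
  have hm1' : (1 - ε) * k' ≤ m := Nat.le_ceil _
  have hk'n : k' ≤ n := hk'.1.1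
  have hmn : m ≤ n := hmk'.trans hk'n
  have hKmR : (k : ℝ) + 1 ≤ m := by exact_mod_cast hKm.le
  have hmk'R : (m : ℝ) ≤ k' := by exact_mod_cast hmk'
  have hm2 : (2 : ℝ) ≤ m := by exact_mod_cast (by omega : 2 ≤ m)
  have hQ1 : (1 : ℝ) ≤ Q := by exact_mod_cast hQ
  have hSge : 1 ≤ S := by omega
  have hS1 : (1 : ℝ) ≤ S := by exact_mod_cast hSge
  -- the range of the indices
  have hj'1 := abs_lt.1 hj'
  have hj'm : j' ≤ m := by
    have : (j' : ℝ) < (m + 1 : ℕ) := by push_cast; linarith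
    have : j' < m + 1 := by exact_mod_cast this
    omega
  have hmj' : m ≤ j' + 1 := by
    have : (m : ℝ) < (j' + 2 : ℕ) := by push_cast; linarith
    have : m < j' + 2 := by exact_mod_cast this
    omega
  have hjk : j ≤ k := by
    have : (j : ℝ) < (k + 1 : ℕ) := by
      push_cast; linarith [(abs_lt.1 hj).2, mul_nonneg hε0.le hk0]
    have : j < k + 1 := by exact_mod_cast this
    omega
  -- the moment of `y` and its mean
  set M := topMoment p y m with hMdef
  have hMk' : m * (k' : ℝ) ^ p ≤ M := le_topMoment_of_isGIndex hp1 hk' hmk'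
  have hk'1 : (1 : ℝ) ≤ k' := by linarith
  have hk'p1 : 1 ≤ (k' : ℝ) ^ p := Real.one_le_rpow hk'1 hp0
  have hMm : (m : ℝ) ≤ M := (le_mul_of_one_le_right (by linarith) hk'p1).trans hMk'
  have hM0 : 0 < M := by linarith
  -- `μ` is the `p`-mean of the top `m` entries of `y`.
  set μ : ℝ := (M / m) ^ (1 / p) with hμdef
  have hMm0 : 0 < M / m := by positivity
  have hμ0 : 0 < μ := Real.rpow_pos_of_pos hMm0 _
  have hμp : μ ^ p = M / m := by
    rw [hμdef, ← Real.rpow_mul hMm0.le, one_div_mul_cancel (by linarith), Real.rpow_one]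
  have hMμ : M = m * μ ^ p := by rw [hμp]; field_simp
  have hk'μ : (k' : ℝ) ≤ μ := by
    have : (k' : ℝ) ^ p ≤ μ ^ p := by
      rw [hμp, le_div_iff₀ (by linarith)]; linarith
    exact (Real.rpow_le_rpow_iff hk'0 hμ0.le (by linarith)).1 this
  -- The failure assumption gives `(1 + ε) * (k + 1) < m ≤ k'`; as `p ≥ 1`, the factor survives
  -- taking `p`-th powers.
  have hxM : (1 + ε) * topMoment p x m ≤ M := by
    have h1 := topMoment_le_of_isGIndex hp1 hk hKm.le hmn
    have h2 : (1 + ε) * ((k : ℝ) + 1) ^ p ≤ (k' : ℝ) ^ p := by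
      calc (1 + ε) * ((k : ℝ) + 1) ^ p ≤ (1 + ε) ^ p * ((k : ℝ) + 1) ^ p := by
            gcongr
            simpa using Real.rpow_le_rpow_of_exponent_le (by linarith : 1 ≤ 1 + ε) hp1
        _ = ((1 + ε) * ((k : ℝ) + 1)) ^ p := (Real.mul_rpow (by linarith) (by linarith)).symm
        _ ≤ (k' : ℝ) ^ p := Real.rpow_le_rpow (by positivity) (by linarith) hp0
    calc (1 + ε) * topMoment p x m ≤ (1 + ε) * (m * ((k : ℝ) + 1) ^ p) := by gcongr
      _ = m * ((1 + ε) * ((k : ℝ) + 1) ^ p) := by ring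
      _ ≤ m * (k' : ℝ) ^ p := by gcongr
      _ ≤ M := hMk'
  have hxM' : topMoment p x m ≤ M := by
    have := mul_nonneg hε0.le (topMoment_nonneg (p := p) x m)
    linarith
  -- size of the entries
  have hbound : ∀ z : Fin n → ℤ, (∀ i, |z i| ≤ (n : ℤ) ^ d) → ∀ i, |(z i : ℝ)| ≤ 2 ^ (d * Q) := by
    intro z hz i
    have h1 : |(z i : ℝ)| ≤ (n : ℝ) ^ d := by exact_mod_cast hz i
    have h2 : (n : ℝ) ≤ 2 ^ Q := by exact_mod_cast hn
    calc |(z i : ℝ)| ≤ (n : ℝ) ^ d := h1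
      _ ≤ (2 ^ Q) ^ d := by gcongr
      _ = 2 ^ (d * Q) := by rw [← pow_mul, mul_comm]
  have hMup : M ≤ m * 2 ^ (2 * d * Q) := by
    have h1 : M ≤ ∑ _i ∈ Finset.Icc 1 m, (2 : ℝ) ^ (2 * d * Q) := by
      rw [hMdef, topMoment_eq]
      refine Finset.sum_le_sum fun i _ => ?_
      have h := mag_le (by positivity) (hbound y hy) i
      calc mag y i ^ p ≤ ((2 : ℝ) ^ (d * Q)) ^ p := Real.rpow_le_rpow (mag_nonneg _ _) h hp0
        _ ≤ ((2 : ℝ) ^ (d * Q)) ^ (2 : ℝ) :=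
          Real.rpow_le_rpow_of_exponent_le (one_le_pow₀ (by norm_num)) hp2
        _ = 2 ^ (2 * d * Q) := by rw [Real.rpow_two, ← pow_mul]; congr 1; ring
    simpa using h1
  -- the residual masses
  have hLx : (tailSq x j : ℝ) ≤ L * (8 * (m * μ ^ 2)) := by
    refine htail.trans (mul_le_mul_of_nonneg_left ?_ (by linarith))
    refine (index_energy_le hp1 hε1 hε0 hk (by omega) hj hm2 hKmR hmk'R (by linarith)).trans ?_
    gcongr
  have hLy : (tailSq y j' : ℝ) ≤ L * (8 * (m * μ ^ 2)) := by
    refine htail'.trans (mul_le_mul_of_nonneg_left ?_ (by linarith))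
    exact own_energy_le hp1 (by omega) hj'm (by omega) hμ0 hMμ
  -- the separating threshold
  obtain ⟨a, ha, r, hr, hr1, htM, hgap⟩ := exists_threshold hp1 x y (by omega : 1 ≤ m) hmn hQ
    hε1.le hQε hxM hMm hMup
  set t : ℝ := 2 ^ a * r / (16 * Q) with ht
  have ht0 : 1 / (16 * Q) ≤ t := by
    rw [ht]
    gcongr
    have h1 : (1 : ℝ) ≤ 2 ^ a := one_le_pow₀ (by norm_num)
    have h2 : (1 : ℝ) ≤ r := by exact_mod_cast hr1
    exact one_le_mul_of_one_le_of_one_le h1 h2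
  set v₀ : ℝ := 1 / (16 * Q) with hv₀
  have hv₀0 : 0 < v₀ := by positivity
  -- The smallest scale is at most 1 and below every grid threshold, so the telescoping sum starts
  -- at excess zero.
  have hv₀t : v₀ ^ p ≤ t := by
    refine le_trans ?_ ht0
    have hv1 : v₀ ≤ 1 := by
      rw [hv₀, div_le_one (by positivity)]; linarith
    simpa using Real.rpow_le_rpow_of_exponent_ge hv₀0 hv1 hp1
  have hcover : (2 : ℝ) ^ (d * Q) ≤ v₀ * 2 ^ S := by
    have h1 : (Q : ℝ) ≤ 2 ^ Q := by exact_mod_cast Nat.lt_two_pow_self.le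
    have h2 : (2 : ℝ) ^ S = 2 ^ (d * Q) * 2 ^ Q * 16 := by
      rw [hS, pow_add, pow_add]; norm_num
    rw [hv₀, h2, div_mul_eq_mul_div, le_div_iff₀ (by positivity)]
    calc (2 : ℝ) ^ (d * Q) * (16 * Q) ≤ 2 ^ (d * Q) * (16 * 2 ^ Q) := by gcongr
      _ = _ := by ring
  have hdecomp : ∀ z : Fin n → ℤ, (∀ i, |z i| ≤ (n : ℤ) ^ d) →
      ∑ l, excess p t |(z l : ℝ)| = ∑ s ∈ Finset.range S, ∑ i, piece p t (v₀ * 2 ^ s) (z i) := by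
    intro z hz
    rw [Finset.sum_comm]
    exact Finset.sum_congr rfl fun i _ =>
      (sum_piece hp0 hv₀0 hv₀t S ((hbound z hz i).trans hcover)).symm
  rw [hdecomp x hx, hdecomp y hy, ← Finset.sum_sub_distrib] at hgap
  -- every scale contributes little
  have hS4 : (4 : ℝ) ≤ S := by exact_mod_cast (by omega : 4 ≤ S)
  have hmQ : (m : ℝ) ≤ 2 ^ Q := by exact_mod_cast hmn.trans hn
  have hμt : μ ^ p ≤ 32 * Q * t := by rw [hμp, div_le_iff₀ (by linarith)]; linarith
  have hscale : ∀ s ∈ Finset.range S, ∑ i, piece p t (v₀ * 2 ^ s) (y i) -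
      ∑ i, piece p t (v₀ * 2 ^ s) (x i) ≤ M / (8 * Q * S) := by
    intro s hs
    have hs := Finset.mem_range.1 hs
    rw [hMμ]
    refine piece_gap_le hp1 hp2 hQ1 hS4 hL hη₁ hμ0 (by omega) hmQ (by positivity) hμt hMμ (by omega)
      (by omega) hj'm (by rw [← hMμ]; exact (topMoment_mono x (by omega)).trans hxM') hLx hLy ?_
    exact fun l hl => hclose l hl s hs a ha r hr
  have hfin := hgap.trans (Finset.sum_le_card_nsmul _ _ _ hscale)
  rw [Finset.card_range, nsmul_eq_mul] at hfin
  have e1 : (S : ℝ) * (M / (8 * Q * S)) = M / (8 * Q) := by field_simp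
  have e2 : M / (4 * Q) = 2 * (M / (8 * Q)) := by field_simp; norm_num
  have e3 : 0 < M / (8 * Q) := by positivity
  linarith

end Separation

/-! ### Choice of parameters and the polynomial space bound -/

section Parameters

/-- The number of dyadic scales. -/
def numScales (d Q : ℕ) : ℕ := d * Q + Q + 4

/-- The number of combinations of a level, a scale and a threshold. -/
def numTests (d Q : ℕ) : ℕ := (Q + 1) * numScales d Q * (2 * d * Q + 1) * (32 * Q + 2)

/-- The tolerance for the error due to sampling. -/
def sampleTol (d e D Q : ℕ) : ℕ :=
  4 * D * numTests d Q * (18 * (64 * Q * numScales d Q * 2) * Q ^ e * (128 * Q))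

/-- The bound that defines lightness. -/
def lightBound (d e D Q : ℕ) : ℕ :=
  18 * (64 * Q * numScales d Q * (sampleTol d e D Q + 1)) * Q ^ e * (128 * Q)

/-- The reciprocal of the expected error due to collisions. -/
def hashPrecision (d D Q : ℕ) : ℕ := 2 * D * numTests d Q * (64 * Q * numScales d Q)

/-- The number of buckets per level. -/
def numBuckets (d e D Q : ℕ) : ℕ := 200 * lightBound d e D Q ^ 5 * hashPrecision d D Q ^ 4

/-- The number of bits that the sketch uses. -/
def numBits (d e D Q : ℕ) : ℕ :=
  Q + (d * Q + 2) + (Q + 1) * numBuckets d e D Q * (Q * (d + 1) + 1 + 1)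

variable {d e D Q : ℕ}

lemma numTests_pos : 0 < numTests d Q := by unfold numTests numScales; positivity

lemma numScales_pos : 0 < numScales d Q := by unfold numScales; positivity

lemma sampleTol_pos (hD : 1 ≤ D) (hQ : 1 ≤ Q) : 1 ≤ sampleTol d e D Q := by
  have := numTests_pos (d := d) (Q := Q)
  have := numScales_pos (d := d) (Q := Q)
  have : 0 < sampleTol d e D Q := by unfold sampleTol; positivity
  omega

lemma lightBound_pos (hQ : 1 ≤ Q) : 1 ≤ lightBound d e D Q := by
  have := numScales_pos (d := d) (Q := Q)
  have : 0 < lightBound d e D Q := by unfold lightBound; positivity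
  omega

lemma hashPrecision_pos (hD : 1 ≤ D) (hQ : 1 ≤ Q) : 1 ≤ hashPrecision d D Q := by
  have := numTests_pos (d := d) (Q := Q)
  have := numScales_pos (d := d) (Q := Q)
  have : 0 < hashPrecision d D Q := by unfold hashPrecision; positivity
  omega

lemma numBuckets_pos (hD : 1 ≤ D) (hQ : 1 ≤ Q) : 0 < numBuckets d e D Q := by
  have := lightBound_pos (d := d) (e := e) (D := D) hQ
  have := hashPrecision_pos (d := d) hD hQ
  unfold numBuckets; positivity

/-- The failure probability of one test. -/
lemma test_failure_le (hD : 1 ≤ D) (hQ : 1 ≤ Q) :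
    1 / ((hashPrecision d D Q : ℝ) * (1 / (64 * Q * numScales d Q))) +
      2 * (lightBound d e D Q : ℝ) / (sampleTol d e D Q : ℝ) ^ 2 ≤ 1 / (D * numTests d Q) := by
  have hP : (0 : ℝ) < numTests d Q := by exact_mod_cast numTests_pos
  have hS : (0 : ℝ) < numScales d Q := by exact_mod_cast numScales_pos
  have hQ' : (0 : ℝ) < Q := by exact_mod_cast hQ
  have hD' : (0 : ℝ) < D := by exact_mod_cast hD
  have hη : (1 : ℝ) ≤ sampleTol d e D Q := by exact_mod_cast sampleTol_pos hD hQ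
  have e1 : 1 / ((hashPrecision d D Q : ℝ) * (1 / (64 * Q * numScales d Q))) =
      1 / (2 * (D * numTests d Q)) := by
    unfold hashPrecision; push_cast; field_simp
  -- The lightness bound is linear in `sampleTol` while Chebyshev gains its square. Thus, although
  -- each depends on the other, a large `sampleTol` suffices.
  have e2 : 2 * (lightBound d e D Q : ℝ) / (sampleTol d e D Q : ℝ) ^ 2 ≤
      1 / (2 * (D * numTests d Q)) := by
    rw [div_le_div_iff₀ (by positivity) (by positivity)]
    set A : ℝ := 18 * (64 * Q * numScales d Q * 2) * Q ^ e * (128 * Q)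
    have h1 : (sampleTol d e D Q : ℝ) = 4 * D * numTests d Q * A := by
      unfold sampleTol; push_cast; rfl
    have h2 : 2 * (lightBound d e D Q : ℝ) = A * (sampleTol d e D Q + 1) := by
      unfold lightBound; push_cast; simp only [A]; ring
    have hA : 0 ≤ A := by positivity
    calc 2 * (lightBound d e D Q : ℝ) * (2 * (D * numTests d Q))
        = A * (sampleTol d e D Q + 1) * (2 * (D * numTests d Q)) := by rw [h2]
      _ ≤ A * (2 * sampleTol d e D Q) * (2 * (D * numTests d Q)) := by gcongr; linarith
      _ = (4 * D * numTests d Q * A) * sampleTol d e D Q := by ring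
      _ = 1 * (sampleTol d e D Q : ℝ) ^ 2 := by rw [← h1]; ring
  rw [e1]
  calc _ ≤ 1 / (2 * (D * numTests d Q : ℝ)) + 1 / (2 * (D * numTests d Q)) := by gcongr
    _ = _ := by field_simp; norm_num

/-- Functions bounded by a polynomial on the positive integers. -/
def PolyBounded (f : ℕ → ℕ) : Prop := ∃ C : ℕ, ∀ Q, 1 ≤ Q → f Q ≤ C * Q ^ C

lemma polyBounded_const (a : ℕ) : PolyBounded fun _ => a :=
  ⟨a, fun _ hQ => Nat.le_mul_of_pos_right _ (Nat.pow_pos hQ)⟩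

lemma polyBounded_id : PolyBounded fun Q => Q := ⟨1, fun Q _ => by simp⟩

lemma PolyBounded.add {f g : ℕ → ℕ} (hf : PolyBounded f) (hg : PolyBounded g) :
    PolyBounded fun Q => f Q + g Q := by
  obtain ⟨a, ha⟩ := hf
  obtain ⟨b, hb⟩ := hg
  refine ⟨a + b, fun Q hQ => ?_⟩
  have h1 : Q ^ a ≤ Q ^ (a + b) := Nat.pow_le_pow_right hQ (by omega)
  have h2 : Q ^ b ≤ Q ^ (a + b) := Nat.pow_le_pow_right hQ (by omega)
  calc f Q + g Q ≤ a * Q ^ a + b * Q ^ b := add_le_add (ha Q hQ) (hb Q hQ)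
    _ ≤ a * Q ^ (a + b) + b * Q ^ (a + b) := by gcongr
    _ = _ := by ring

lemma PolyBounded.mul {f g : ℕ → ℕ} (hf : PolyBounded f) (hg : PolyBounded g) :
    PolyBounded fun Q => f Q * g Q := by
  obtain ⟨a, ha⟩ := hf
  obtain ⟨b, hb⟩ := hg
  refine ⟨a * b + a + b, fun Q hQ => ?_⟩
  calc f Q * g Q ≤ (a * Q ^ a) * (b * Q ^ b) := Nat.mul_le_mul (ha Q hQ) (hb Q hQ)
    _ = (a * b) * Q ^ (a + b) := by ring
    _ ≤ (a * b + a + b) * Q ^ (a * b + a + b) :=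
      Nat.mul_le_mul (by omega) (Nat.pow_le_pow_right hQ (by omega))

lemma PolyBounded.pow {f : ℕ → ℕ} (hf : PolyBounded f) (k : ℕ) : PolyBounded fun Q => f Q ^ k := by
  induction k with
  | zero => simpa using polyBounded_const 1
  | succ k ih => simpa only [pow_succ] using ih.mul hf

lemma polyBounded_numBits (d e D : ℕ) : PolyBounded (numBits d e D) := by
  have hc := polyBounded_const
  have hQ := polyBounded_id
  have hS : PolyBounded (numScales d) := (((hc d).mul hQ).add hQ).add (hc 4)
  have hP : PolyBounded (numTests d) :=
    (((hQ.add (hc 1)).mul hS).mul ((((hc 2).mul (hc d)).mul hQ).add (hc 1))).mul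
      (((hc 32).mul hQ).add (hc 2))
  have hη : PolyBounded (sampleTol d e D) :=
    (((hc 4).mul (hc D)).mul hP).mul ((((hc 18).mul ((((hc 64).mul hQ).mul hS).mul (hc 2))).mul
      (hQ.pow e)).mul ((hc 128).mul hQ))
  have hΛ : PolyBounded (lightBound d e D) :=
    (((hc 18).mul ((((hc 64).mul hQ).mul hS).mul (hη.add (hc 1)))).mul (hQ.pow e)).mul
      ((hc 128).mul hQ)
  have hZ : PolyBounded (hashPrecision d D) :=
    (((hc 2).mul (hc D)).mul hP).mul (((hc 64).mul hQ).mul hS)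
  have hB : PolyBounded (numBuckets d e D) := ((hc 200).mul (hΛ.pow 5)).mul (hZ.pow 4)
  exact (hQ.add (((hc d).mul hQ).add (hc 2))).add
    (((hQ.add (hc 1)).mul hB).mul (((hQ.mul ((hc d).add (hc 1))).add (hc 1)).add (hc 1)))

end Parameters

/-! ### The sketch, its decoder and its success probability -/

section Assembly

variable {n : ℕ}

/-- The scale `v` with index `s`. -/
noncomputable def testScale (Q s : ℕ) : ℝ := 1 / (16 * Q) * 2 ^ s

/-- The threshold `t` with index `(a, r)`. -/
noncomputable def testThreshold (Q a r : ℕ) : ℝ := 2 ^ a * r / (16 * Q)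

/-- The buckets represent one piece of the input. -/
def GoodTest (p : ℝ) (d e D Q : ℕ) (ω : Fin n → Cell Q (numBuckets d e D Q)) (x : Fin n → ℤ)
    (l s a r : ℕ) : Prop :=
  IsLight (lightBound d e D Q) l (testScale Q s) x →
    |∑ b, piece p (testThreshold Q a r) (testScale Q s) (bucketVal ω l b x) -
        (1 / 2) ^ l * ∑ i, piece p (testThreshold Q a r) (testScale Q s) (x i)| ≤
      4 * testScale Q s ^ p * (1 / (64 * Q * numScales d Q) + (1 - (1 / 2) ^ l) * sampleTol d e D Q)

/-- The buckets represent all pieces of the input. -/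
def Good (p : ℝ) (d e D Q : ℕ) (ω : Fin n → Cell Q (numBuckets d e D Q)) (x : Fin n → ℤ) : Prop :=
  ∀ l ≤ Q, ∀ s < numScales d Q, ∀ a ≤ 2 * d * Q, ∀ r ≤ 32 * Q + 1, GoodTest p d e D Q ω x l s a r

lemma card_not_good_le {p : ℝ} (hp1 : 1 ≤ p) (hp2 : p ≤ 2) {d e D Q : ℕ} (hD : 1 ≤ D) (hQ : 1 ≤ Q)
    (x : Fin n → ℤ)
    [DecidablePred fun ω : Fin n → Cell Q (numBuckets d e D Q) => ¬ Good p d e D Q ω x] :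
    (D : ℝ) * (Finset.univ.filter fun ω : Fin n → Cell Q (numBuckets d e D Q) =>
      ¬ Good p d e D Q ω x).card ≤ Fintype.card (Fin n → Cell Q (numBuckets d e D Q)) := by
  classical
  have : NeZero (numBuckets d e D Q) := ⟨(numBuckets_pos hD hQ).ne'⟩
  set Ω := Fin n → Cell Q (numBuckets d e D Q)
  set I := Finset.range (Q + 1) ×ˢ Finset.range (numScales d Q) ×ˢ Finset.range (2 * d * Q + 1) ×ˢ
    Finset.range (32 * Q + 2)
  have hP : (0 : ℝ) < numTests d Q := by exact_mod_cast numTests_pos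
  have hS : (0 : ℝ) < numScales d Q := by exact_mod_cast numScales_pos
  have hQ' : (0 : ℝ) < Q := by exact_mod_cast hQ
  have hD' : (0 : ℝ) < D := by exact_mod_cast hD
  have hI : (I.card : ℝ) = numTests d Q := by
    simp only [I, Finset.card_product, Finset.card_range, numTests]
    push_cast; ring
  have hsub : (Finset.univ.filter fun ω : Ω => ¬ Good p d e D Q ω x) ⊆
      I.biUnion fun i => Finset.univ.filter fun ω : Ω =>
        ¬ GoodTest p d e D Q ω x i.1 i.2.1 i.2.2.1 i.2.2.2 := by
    intro ω hω
    have hω := (Finset.mem_filter.1 hω).2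
    unfold Good at hω
    push Not at hω
    obtain ⟨l, hl, s, hs, a, ha, r, hr, h⟩ := hω
    refine Finset.mem_biUnion.2 ⟨(l, s, a, r), ?_, Finset.mem_filter.2 ⟨Finset.mem_univ _, h⟩⟩
    simp only [I, Finset.mem_product, Finset.mem_range]
    omega
  have htest : ∀ i ∈ I, ((Finset.univ.filter fun ω : Ω =>
      ¬ GoodTest p d e D Q ω x i.1 i.2.1 i.2.2.1 i.2.2.2).card : ℝ) ≤
        1 / (D * numTests d Q) * Fintype.card Ω := by
    rintro ⟨l, s, a, r⟩ hi
    simp only [I, Finset.mem_product, Finset.mem_range] at hi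
    by_cases hlight : IsLight (lightBound d e D Q) l (testScale Q s) x
    · have hv : 0 < testScale Q s := by unfold testScale; positivity
      have ht : 0 ≤ testThreshold Q a r := by unfold testThreshold; positivity
      have h := card_bad_piece_le (W := Q) (B := numBuckets d e D Q) hp1 hp2 ht hv
        (by omega : l ≤ Q) x (Λ := lightBound d e D Q) (Z := hashPrecision d D Q)
        (η₀ := 1 / (64 * Q * numScales d Q)) (η₁ := sampleTol d e D Q)
        (by exact_mod_cast lightBound_pos hQ) (by exact_mod_cast hashPrecision_pos hD hQ)
        (by unfold numBuckets; push_cast; exact le_rfl) (by positivity)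
        (by exact_mod_cast sampleTol_pos hD hQ) hlight
      refine le_trans ?_ (h.trans (mul_le_mul_of_nonneg_right (test_failure_le hD hQ)
        (Nat.cast_nonneg _)))
      refine le_of_eq ?_
      congr 2
      refine Finset.filter_congr fun ω _ => not_congr ?_
      exact ⟨fun h => h hlight, fun h _ => h⟩
    · have hgood : ∀ ω : Ω, GoodTest p d e D Q ω x l s a r := fun ω h => absurd h hlight
      simp only [hgood, not_true_eq_false, Finset.filter_false, Finset.card_empty, Nat.cast_zero]
      positivity
  have hcard : ((Finset.univ.filter fun ω : Ω => ¬ Good p d e D Q ω x).card : ℝ) ≤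
      1 / D * Fintype.card Ω := by
    calc ((Finset.univ.filter fun ω : Ω => ¬ Good p d e D Q ω x).card : ℝ)
        ≤ ∑ i ∈ I, ((Finset.univ.filter fun ω : Ω =>
          ¬ GoodTest p d e D Q ω x i.1 i.2.1 i.2.2.1 i.2.2.2).card : ℝ) := by
          exact_mod_cast (Finset.card_le_card hsub).trans Finset.card_biUnion_le
      _ ≤ ∑ _i ∈ I, 1 / (D * numTests d Q : ℝ) * Fintype.card Ω := Finset.sum_le_sum htest
      _ = _ := by
        rw [Finset.sum_const, nsmul_eq_mul, hI]; field_simp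
  calc (D : ℝ) * _ ≤ D * (1 / D * Fintype.card Ω) := by gcongr
    _ = Fintype.card Ω := by field_simp

/-- The promise on the input `x` with index `k`. -/
def Promise (p ε L : ℝ) (d : ℕ) (x : Fin n → ℤ) (k : ℕ) : Prop :=
  (∀ i, |x i| ≤ (n : ℤ) ^ d) ∧ IsGIndex p x k ∧
    ∃ j : ℕ, |(j : ℝ) - (1 - ε) * k| < 1 ∧ (tailSq x j : ℝ) ≤ L * (j * mag x j ^ 2)

/-- Two inputs with the same sketch, both represented well by the buckets. -/
lemma ceil_index_le_of_good {p ε : ℝ} (hp1 : 1 ≤ p) (hp2 : p ≤ 2) (hε0 : 0 < ε) (hε1 : ε < 1)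
    {d e D Q : ℕ} (hQ : 1 ≤ Q) (hQε : 1 / (Q : ℝ) ≤ ε) (hn : n ≤ 2 ^ Q)
    (ω : Fin n → Cell Q (numBuckets d e D Q)) {x y : Fin n → ℤ} {k k' : ℕ}
    (hx : Promise p ε ((Q : ℝ) ^ e) d x k) (hy : Promise p ε ((Q : ℝ) ^ e) d y k')
    (hgx : Good p d e D Q ω x) (hgy : Good p d e D Q ω y)
    (hxy : ∀ l ≤ Q, ∀ b, bucketVal ω l b y = bucketVal ω l b x) :
    (⌈(1 - ε) * k'⌉₊ : ℝ) ≤ (1 + ε) * (k + 1) := by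
  obtain ⟨hx1, hxk, j, hj, htail⟩ := hx
  obtain ⟨hy1, hyk, j', hj', htail'⟩ := hy
  refine ceil_index_le hp1 hp2 hε0 hε1 hQ hQε hn (S := numScales d Q) rfl
    (one_le_pow₀ (by exact_mod_cast hQ)) (η₁ := sampleTol d e D Q) (Nat.cast_nonneg _)
    hy1 hx1 hxk hyk hj hj' htail htail' ?_
  intro l hl s hs a ha r hr hlx hly
  have hΛ : (18 * (64 * Q * numScales d Q * (sampleTol d e D Q + 1)) * (Q : ℝ) ^ e * (128 * Q)) =
      (lightBound d e D Q : ℝ) := by unfold lightBound; push_cast; rfl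
  rw [hΛ] at hlx hly
  have h1 := abs_le.1 (hgx l hl s hs a ha r hr hlx)
  have h2 := abs_le.1 (hgy l hl s hs a ha r hr hly)
  simp only [hxy l hl, testScale, testThreshold] at h1 h2
  set Y := ∑ i, piece p (2 ^ a * r / (16 * Q)) (1 / (16 * Q) * 2 ^ s) (y i)
  set X := ∑ i, piece p (2 ^ a * r / (16 * Q)) (1 / (16 * Q) * 2 ^ s) (x i)
  set V := (1 / (16 * Q) * 2 ^ s : ℝ) ^ p
  set E := (1 / (64 * Q * numScales d Q : ℝ) + (1 - (1 / 2) ^ l) * sampleTol d e D Q)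
  have e1 : (2 : ℝ) ^ l * (1 / 2) ^ l = 1 := by rw [← mul_pow]; norm_num
  have h3 : (1 / 2) ^ l * (Y - X) ≤ 8 * V * E := by
    have e2 : (1 / 2) ^ l * (Y - X) = (1 / 2) ^ l * Y - (1 / 2) ^ l * X := by ring
    have e3 : 8 * V * E = 4 * V * E + 4 * V * E := by ring
    linarith [h1.1, h1.2, h2.1, h2.2]
  calc Y - X = 2 ^ l * ((1 / 2) ^ l * (Y - X)) := by rw [← mul_assoc, e1, one_mul]
    _ ≤ 2 ^ l * (8 * V * E) := by gcongr

/-- The linear sketch determined by a family of hash functions. The decoder returns the largest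
rounded-up index compatible with the sketch. -/
noncomputable def indexSketch (p ε : ℝ) (d e D Q r : ℕ)
    (g : (Fin r → Bool) → Fin n → Cell Q (numBuckets d e D Q)) : LinearSketch n where
  seedBits := r
  rows := (Q + 1) * numBuckets d e D Q
  mat s := fun ρ i => cellEntry (finProdFinEquiv.symm ρ).1 (finProdFinEquiv.symm ρ).2 (g s i)
  decode s w := sSup {m | ∃ y k, Promise p ε ((Q : ℝ) ^ e) d y k ∧ Good p d e D Q (g s) y ∧
    (∀ ρ, bucketVal (g s) (finProdFinEquiv.symm ρ).1 (finProdFinEquiv.symm ρ).2 y = w ρ) ∧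
    m = ⌈(1 - ε) * k⌉₊}

variable {p ε : ℝ} {d e D Q r : ℕ} (g : (Fin r → Bool) → Fin n → Cell Q (numBuckets d e D Q))

lemma indexSketch_mulVec (s : Fin r → Bool) (x : Fin n → ℤ) (ρ) :
    ((indexSketch p ε d e D Q r g).mat s).mulVec x ρ =
      bucketVal (g s) (finProdFinEquiv.symm ρ).1 (finProdFinEquiv.symm ρ).2 x := rfl

lemma abs_bucketVal_le {W B : ℕ} (ω : Fin n → Cell W B) (l : ℕ) (b : Fin B) (x : Fin n → ℤ) {m : ℤ}
    (hx : ∀ i, |x i| ≤ m) : |bucketVal ω l b x| ≤ n * m := by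
  refine (Finset.abs_sum_le_sum_abs _ _).trans ?_
  have : ∀ i ∈ Finset.univ, |cellEntry l b (ω i) * x i| ≤ m := by
    intro i _
    refine le_trans ?_ (hx i)
    rcases cellEntry_cases l b (ω i) with h | h | h <;> simp [h]
  simpa using Finset.sum_le_card_nsmul _ _ _ this

lemma usesBits_indexSketch (hn : n ≤ 2 ^ Q)
    (g : (Fin (Q + (d * Q + 2)) → Bool) → Fin n → Cell Q (numBuckets d e D Q)) :
    (indexSketch p ε d e D Q (Q + (d * Q + 2)) g).UsesBits ((n : ℤ) ^ d) (numBits d e D Q) := by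
  refine ⟨Q * (d + 1) + 1, fun s x hx ρ => ?_, le_rfl⟩
  change |bucketVal (g s) (finProdFinEquiv.symm (ρ : Fin ((Q + 1) * numBuckets d e D Q))).1 _ x| < _
  refine (abs_bucketVal_le _ _ _ x hx).trans_lt ?_
  have h1 : (n : ℤ) ≤ 2 ^ Q := by exact_mod_cast hn
  calc (n : ℤ) * n ^ d = n ^ (d + 1) := by ring
    _ ≤ (2 ^ Q) ^ (d + 1) := by gcongr
    _ = 2 ^ (Q * (d + 1)) := by rw [← pow_mul]
    _ < _ := pow_lt_pow_right₀ (by norm_num) (Nat.lt_succ_self _)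

/-- The input is itself a candidate, which bounds the maximum from below; a candidate attaining the
maximum is compared with the input for the upper bound. -/
lemma indexSketch_output_mem (hp1 : 1 ≤ p) (hp2 : p ≤ 2) (hε0 : 0 < ε) (hε1 : ε < 1)
    (hQ : 1 ≤ Q) (hQε : 1 / (Q : ℝ) ≤ ε) (hn : n ≤ 2 ^ Q) {x : Fin n → ℤ} {k : ℕ}
    (hx : Promise p ε ((Q : ℝ) ^ e) d x k) (s : Fin r → Bool) (hg : Good p d e D Q (g s) x) :
    (1 - ε) * k ≤ (indexSketch p ε d e D Q r g).output s x ∧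
      ((indexSketch p ε d e D Q r g).output s x : ℝ) ≤ (1 + ε) * (k + 1) := by
  set T := {m | ∃ y k', Promise p ε ((Q : ℝ) ^ e) d y k' ∧ Good p d e D Q (g s) y ∧
    (∀ ρ, bucketVal (g s) (finProdFinEquiv.symm ρ).1 (finProdFinEquiv.symm ρ).2 y =
      ((indexSketch p ε d e D Q r g).mat s).mulVec x ρ) ∧ m = ⌈(1 - ε) * k'⌉₊} with hT
  have hout : (indexSketch p ε d e D Q r g).output s x = sSup T := rfl
  have hxT : ⌈(1 - ε) * k⌉₊ ∈ T := ⟨x, k, hx, hg, fun ρ => rfl, rfl⟩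
  -- Without boundedness the supremum in `ℕ` would take the default value 0.
  have hbdd : BddAbove T := by
    refine ⟨n, ?_⟩
    rintro m ⟨y, k', hy, _, _, rfl⟩
    refine (Nat.ceil_le.2 ?_).trans hy.2.1.1.1
    have : (0 : ℝ) ≤ k' := Nat.cast_nonneg _
    nlinarith
  rw [hout]
  constructor
  · exact (Nat.le_ceil _).trans (by exact_mod_cast le_csSup hbdd hxT)
  · obtain ⟨y, k', hy, hgy, hsk, hm⟩ := Nat.sSup_mem ⟨_, hxT⟩ hbdd
    rw [hm]
    refine ceil_index_le_of_good hp1 hp2 hε0 hε1 hQ hQε hn (g s) hx hy hg hgy ?_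
    intro l hl b
    have := (hsk (finProdFinEquiv (⟨l, by omega⟩, b))).trans (indexSketch_mulVec g s x _)
    simpa using this

/-- The logarithm of the number of inputs is at most `n * (d * Q + 2)`, which is below `2 ^ r` for a
seed length `r` linear in `Q`. -/
lemma card_box_lt {Q d n : ℕ} (hn0 : 0 < n) (hn : n ≤ 2 ^ Q) :
    (Fintype.piFinset fun _ : Fin n => Finset.Icc (-((n : ℤ) ^ d)) ((n : ℤ) ^ d)).card <
      2 ^ 2 ^ (Q + (d * Q + 2)) := by
  rw [Fintype.card_piFinset]
  have h1 : (Finset.Icc (-((n : ℤ) ^ d)) ((n : ℤ) ^ d)).card = 2 * n ^ d + 1 := by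
    rw [Int.card_Icc]
    have : (n : ℤ) ^ d + 1 - -((n : ℤ) ^ d) = ((2 * n ^ d + 1 : ℕ) : ℤ) := by push_cast; ring
    rw [this, Int.toNat_natCast]
  simp only [h1, Finset.prod_const, Finset.card_univ, Fintype.card_fin]
  have h2 : 2 * n ^ d + 1 ≤ 2 ^ (d * Q + 2) := by
    have h3 : n ^ d ≤ 2 ^ (d * Q) := by
      calc n ^ d ≤ (2 ^ Q) ^ d := Nat.pow_le_pow_left hn d
        _ = 2 ^ (d * Q) := by rw [← pow_mul, mul_comm]
    have h4 : 0 < 2 ^ (d * Q) := by positivity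
    rw [pow_add]
    omega
  calc (2 * n ^ d + 1) ^ n ≤ (2 ^ (d * Q + 2)) ^ n := Nat.pow_le_pow_left h2 n
    _ = 2 ^ (n * (d * Q + 2)) := by rw [← pow_mul, mul_comm]
    _ < 2 ^ 2 ^ (Q + (d * Q + 2)) := by
      refine Nat.pow_lt_pow_right (by norm_num) ?_
      rw [pow_add]
      calc n * (d * Q + 2) < n * 2 ^ (d * Q + 2) := Nat.mul_lt_mul_of_pos_left Nat.lt_two_pow_self hn0
        _ ≤ _ := Nat.mul_le_mul_right _ hn

lemma LinearSketch.le_prob {A : LinearSketch n} {x : Fin n → ℤ} {P : ℕ → Prop}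
    {G : (Fin A.seedBits → Bool) → Prop} [DecidablePred fun s => ¬ G s]
    (hG : ∀ s, G s → P (A.output s x)) {δ : ℝ}
    (hδ : ((Finset.univ.filter fun s => ¬ G s).card : ℝ) ≤ δ * 2 ^ A.seedBits) :
    1 - δ ≤ A.prob x P := by
  classical
  have h1 := Finset.card_filter_add_card_filter_not
    (s := (Finset.univ : Finset (Fin A.seedBits → Bool))) fun s => P (A.output s x)
  rw [Finset.card_univ, Fintype.card_fun, Fintype.card_bool, Fintype.card_fin] at h1
  have h2 : (Finset.univ.filter fun s => ¬ P (A.output s x)).card ≤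
      (Finset.univ.filter fun s => ¬ G s).card :=
    Finset.card_le_card fun s hs => Finset.mem_filter.2
      ⟨Finset.mem_univ _, fun h => (Finset.mem_filter.1 hs).2 (hG s h)⟩
  have h3 : ((Finset.univ.filter fun s => P (A.output s x)).card : ℝ) +
      (Finset.univ.filter fun s => ¬ P (A.output s x)).card = 2 ^ A.seedBits := by exact_mod_cast h1
  have h4 : ((Finset.univ.filter fun s => ¬ P (A.output s x)).card : ℝ) ≤ _ := Nat.cast_le.2 h2
  have h5 : (1 - δ) * 2 ^ A.seedBits ≤
      ((Finset.univ.filter fun s => P (A.output s x)).card : ℝ) := by linarith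
  unfold LinearSketch.prob
  rw [le_div_iff₀ (by positivity)]
  convert h5

lemma le_prob_indexSketch (hp1 : 1 ≤ p) (hp2 : p ≤ 2) (hε0 : 0 < ε) (hε1 : ε < 1)
    (hQ : 1 ≤ Q) (hQε : 1 / (Q : ℝ) ≤ ε) (hn : n ≤ 2 ^ Q) {x : Fin n → ℤ} {k : ℕ}
    (hx : Promise p ε ((Q : ℝ) ^ e) d x k) {δ : ℝ}
    [inst : DecidablePred fun s : Fin r → Bool => ¬ Good p d e D Q (g s) x]
    (hδ : ((Finset.univ.filter fun s : Fin r → Bool => ¬ Good p d e D Q (g s) x).card : ℝ) ≤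
      δ * 2 ^ r) :
    1 - δ ≤ (indexSketch p ε d e D Q r g).prob x
      (fun k' => (1 - ε) * k ≤ (k' : ℝ) ∧ (k' : ℝ) ≤ (1 + ε) * (k + 1)) :=
  @LinearSketch.le_prob n (indexSketch p ε d e D Q r g) x _
    (fun s : Fin r → Bool => Good p d e D Q (g s) x) inst
    (fun s hs => indexSketch_output_mem g hp1 hp2 hε0 hε1 hQ hQε hn hx s hs) δ hδ

/-- A sketch that is correct with probability at least `1 - δ` on every input satisfying the
promise. -/
theorem exists_indexSketch {δ : ℝ} (hδ : 0 < δ) (hp1 : 1 ≤ p) (hp2 : p ≤ 2) (hε0 : 0 < ε)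
    (hε1 : ε < 1) (hD : (4 : ℝ) ^ (1 / δ) ≤ D) (hQ : 1 ≤ Q) (hQε : 1 / (Q : ℝ) ≤ ε) (hn0 : 0 < n)
    (hn : n ≤ 2 ^ Q) :
    ∃ A : LinearSketch n, A.UsesBits ((n : ℤ) ^ d) (numBits d e D Q) ∧
      ∀ x : Fin n → ℤ, ∀ k : ℕ, Promise p ε ((Q : ℝ) ^ e) d x k →
        1 - δ ≤ A.prob x (fun k' => (1 - ε) * k ≤ (k' : ℝ) ∧ (k' : ℝ) ≤ (1 + ε) * (k + 1)) := by
  classical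
  have hD1 : (1 : ℝ) ≤ D :=
    (Real.one_le_rpow (by norm_num) (by positivity : 0 ≤ 1 / δ)).trans hD
  have hD1' : 1 ≤ D := by exact_mod_cast hD1
  have hDδ : (4 : ℝ) ≤ (D : ℝ) ^ δ := by
    calc (4 : ℝ) = ((4 : ℝ) ^ (1 / δ)) ^ δ := by
          rw [← Real.rpow_mul (by norm_num), one_div_mul_cancel hδ.ne', Real.rpow_one]
      _ ≤ (D : ℝ) ^ δ := Real.rpow_le_rpow (by positivity) hD hδ.le
  have : NeZero (numBuckets d e D Q) := ⟨(numBuckets_pos hD1' hQ).ne'⟩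
  obtain ⟨g, hg⟩ := exists_common_seeds (Ω := Fin n → Cell Q (numBuckets d e D Q))
    (Fintype.piFinset fun _ : Fin n => Finset.Icc (-((n : ℤ) ^ d)) ((n : ℤ) ^ d))
    (fun x ω => ¬ Good p d e D Q ω x) hDδ hD1 (Q + (d * Q + 2))
    (fun x _ _ => card_not_good_le hp1 hp2 hD1' hQ x) (card_box_lt hn0 hn)
  refine ⟨indexSketch p ε d e D Q _ g, usesBits_indexSketch hn g, fun x k hx => ?_⟩
  exact le_prob_indexSketch g hp1 hp2 hε0 hε1 hQ hQε hn hx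
    (hg x (Fintype.mem_piFinset.2 fun i => Finset.mem_Icc.2 (abs_le.1 (hx.1 i))))

end Assembly

/-! ### The main theorem -/

theorem corollary8 (c : ℝ) (d : ℕ) (δ : ℝ) (hδ : 0 < δ) :
    ∃ C : ℕ, ∀ (n : ℕ) (p ε : ℝ), 2 ≤ n → 1 ≤ p → p ≤ 2 → 0 < ε → ε < 1 →
      ∃ A : LinearSketch n,
        A.UsesBits ((n : ℤ) ^ d) (C * (Real.logb 2 n / ε) ^ C) ∧
        ∀ x : Fin n → ℤ, (∀ i, |x i| ≤ (n : ℤ) ^ d) →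
          ∀ k : ℕ, IsGIndex p x k →
            -- `j` is `(1 - ε) k`, rounded down or up if it is not an integer
            ∀ j : ℕ, |(j : ℝ) - (1 - ε) * k| < 1 →
              (ε / Real.logb 2 n) ^ c * (tailSq x j : ℝ) ≤ (j : ℝ) * (rearr x j : ℝ) ^ 2 →
              1 - δ ≤ A.prob x
                (fun k' => (1 - ε) * k ≤ (k' : ℝ) ∧ (k' : ℝ) ≤ (1 + ε) * (k + 1)) := by
  -- The exponent `e` makes `Q ^ e` dominate `(log₂ n / ε) ^ c` for either sign of `c`; `D`
  -- satisfies `D ^ δ ≥ 4`, as the choice of common seeds requires.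
  set e := ⌈|c|⌉₊
  set D := ⌈(4 : ℝ) ^ (1 / δ)⌉₊
  obtain ⟨C₀, hC₀⟩ := polyBounded_numBits d e D
  -- The factor `2 ^ C₀` pays for `Q ≤ 2 * Y`; the summand `C₀` makes the same number large enough
  -- as an exponent.
  refine ⟨C₀ * 2 ^ C₀ + C₀, fun n p ε hn2 hp1 hp2 hε0 hε1 => ?_⟩
  have hlog : 1 ≤ Real.logb 2 n := by
    rw [Real.le_logb_iff_rpow_le (by norm_num) (by exact_mod_cast (by omega : 0 < n)),
      Real.rpow_one]
    exact_mod_cast hn2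
  set Y := Real.logb 2 n / ε with hY
  have hlogY : Real.logb 2 n ≤ Y := by
    rw [hY, le_div_iff₀ hε0]; nlinarith
  have hY1 : 1 ≤ Y := hlog.trans hlogY
  -- This single integer dominates both `log₂ n` and `1 / ε` and exceeds `Y` by at most a factor 2.
  set Q := ⌈Y⌉₊
  have hYQ : Y ≤ Q := Nat.le_ceil _
  have hQY : (Q : ℝ) ≤ 2 * Y := by
    have := Nat.ceil_lt_add_one (by linarith : 0 ≤ Y)
    linarith
  have hQ : 1 ≤ Q := by exact_mod_cast hY1.trans hYQ
  have hQε : 1 / (Q : ℝ) ≤ ε := by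
    rw [div_le_iff₀ (by linarith)]
    have : ε * Y = Real.logb 2 n := by rw [hY]; field_simp
    nlinarith
  have hn : n ≤ 2 ^ Q := by
    have h1 : (n : ℝ) ≤ 2 ^ (Q : ℝ) := by
      rw [← Real.logb_le_iff_le_rpow (by norm_num) (by exact_mod_cast (by omega : 0 < n))]
      linarith
    rw [Real.rpow_natCast] at h1
    exact_mod_cast h1
  obtain ⟨A, hA, hprob⟩ := exists_indexSketch (d := d) (e := e) hδ hp1 hp2 hε0 hε1
    (Nat.le_ceil _ : (4 : ℝ) ^ (1 / δ) ≤ D) hQ hQε (by omega : 0 < n) hn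
  refine ⟨A, ?_, fun x hx k hk j hj htail => hprob x k ⟨hx, hk, j, hj, ?_⟩⟩
  · obtain ⟨w, hw, hbits⟩ := hA
    refine ⟨w, hw, hbits.trans ?_⟩
    calc (numBits d e D Q : ℝ) ≤ C₀ * (Q : ℝ) ^ C₀ := by exact_mod_cast hC₀ Q hQ
      _ ≤ C₀ * (2 * Y) ^ C₀ := by gcongr
      _ = (C₀ * 2 ^ C₀) * Y ^ C₀ := by rw [mul_pow]; ring
      _ ≤ ((C₀ * 2 ^ C₀ + C₀ : ℕ) : ℝ) * Y ^ (C₀ * 2 ^ C₀ + C₀) := by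
        push_cast
        gcongr
        · exact le_add_of_nonneg_right (Nat.cast_nonneg _)
        · exact Nat.le_add_left _ _
  · have hY0 : 0 < Y := by linarith
    have hinv : ε / Real.logb 2 n = Y⁻¹ := by rw [hY, inv_div]
    have hYc := Real.rpow_pos_of_pos hY0 c
    rw [hinv, Real.inv_rpow hY0.le, inv_mul_le_iff₀ hYc, ← mag_sq] at htail
    refine htail.trans ?_
    have h0 : 0 ≤ (j : ℝ) * mag x j ^ 2 := by positivity
    refine mul_le_mul_of_nonneg_right ?_ h0
    calc Y ^ c ≤ Y ^ (e : ℝ) :=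
          Real.rpow_le_rpow_of_exponent_le hY1 ((le_abs_self c).trans (Nat.le_ceil _))
      _ = Y ^ e := Real.rpow_natCast _ _
      _ ≤ (Q : ℝ) ^ e := by gcongr
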